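/- A \emph{clutter} $\mathcal{C}$ over a finite ground set $V$ is a family of subsets of $V$ (its \emph{members}), none of which contains another. A \emph{cover} is a subset of $V$ that intersects every member; the \emph{covering number} is the minimum cardinality of a cover; the \emph{blocker} $b(\mathcal{C})$ is the clutter over $V$ of the inclusion-wise minimal covers. For disjoint $I,J\subseteq V$, the \emph{minor} $\mathcal{C}\setminus I/J$ is the clutter over $V-(I\cup J)$ whose members are the inclusion-wise minimal sets in $\{C-J: C\in\mathcal{C},\ C\cap I=\emptyset\}$. A \emph{delta} is a clutter over a ground set $\{a_1,\ldots,a_n\}$, $n\ge 3$, whose members are $\{a_2,\ldots,a_n\}$ and $\{a_1,a_i\}$, $i=2,\ldots,n$. An \emph{extended odd hole} is a clutter over a ground set $\{a_1,\ldots,a_n\}$, $n\geq 5$ odd, whose minimum cardinality members are precisely $\{a_1,a_2\},\ldots,\{a_{n-1},a_n\},\{a_n,a_1\}$. A clutter is \emph{clean} if no minor of it is a delta or the blocker of an extended odd hole, and \emph{tangled} if its covering number is two and every element belongs to a minimum cover. Let $\mathcal{C}$ be a clean tangled clutter over ground set $V$. A \emph{fractional packing} is a $y\in\mathbb{R}^{\mathcal{C}}_{+}$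 with $\sum(y_C: v\in C\in\mathcal{C})\leq 1$ for every $v\in V$; its \emph{value} is $\sum_{C\in\mathcal{C}} y_C$. The \emph{core} of $\mathcal{C}$ is the clutter over $V$ $$\mathrm{core}(\mathcal{C})=\{C\in\mathcal{C}: y_C>0 \text{ for some fractional packing } y \text{ of value two}\}.$$ Let $G(\mathcal{C})$ be the graph on vertex set $V$ whose edges are the minimum covers of $\mathcal{C}$. This graph is bipartite; the \emph{rank} $r$ of $\mathcal{C}$ is its number of connected components, and for each $i\in[r]$, $\{U_i,V_i\}$ denotes the bipartition of the $i$-th connected component. For $S\subseteq\{0,1\}^r$, $\mathrm{cuboid}(S)$ is the clutter over $\{1,\ldots,2r\}$ whose members have incidence vectors $(p_1,1-p_1,\ldots,p_r,1-p_r)$, $p\in S$. A \emph{duplication} of a clutter is obtained by replacing each element by one or more copies of it that lie in the same members (up to relabeling elements). A set $S\subseteq\{0,1\}^r$ is \emph{a setcore} of $\mathcal{C}$ if $\mathrm{core}(\mathcal{C})$ is a duplication of $\mathrm{cuboid}(S)$. The \emph{setcore with respect to} $(U_1,V_1;\ldots;U_r,V_r)$ is the set of the points $p\in\{0,1\}^r$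 given by $p_i=0\Leftrightarrow C\cap(U_i\cup V_i)=U_i$ $(i\in[r])$, as $C$ ranges over $\mathrm{core}(\mathcal{C})$. Then the following statements hold, for every choice of the numbering of the components and of the names $U_i,V_i$ of their parts: (i) If $r=1$, then $\{0,1\}$ is the one and only setcore of $\mathcal{C}$, it is also the setcore with respect to $(U_1,V_1)$, and $\mathrm{core}(\mathcal{C})=\{U_1,V_1\}$. (ii) If $r=2$, then $\{00,10,01,11\}$ is the one and only setcore of $\mathcal{C}$, it is also the setcore with respect to $(U_1,V_1;U_2,V_2)$, and $\mathrm{core}(\mathcal{C})=\{U_1\cup U_2,\,U_1\cup V_2,\,V_1\cup U_2,\,V_1\cup V_2\}$. (iii) If $r=3$ and $\mathcal{C}$ does not have two disjoint members, then the setcores of $\mathcal{C}$ are precisely the two sets $\{000,110,101,011\}$ and $\{100,010,001,111\}$, and either the setcore with respect to $(U_1,V_1;U_2,V_2;U_3,V_3)$ is $\{000,110,101,011\}$ and $$\mathrm{core}(\mathcal{C})=\{U_1\cup U_2\cup U_3,\,U_1\cup V_2\cup V_3,\,V_1\cup U_2\cup V_3,\,V_1\cup V_2\cup U_3\},$$ or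 the setcore with respect to $(U_1,V_1;U_2,V_2;U_3,V_3)$ is $\{100,010,001,111\}$ and $$\mathrm{core}(\mathcal{C})=\{U_1\cup U_2\cup V_3,\,U_1\cup V_2\cup U_3,\,V_1\cup U_2\cup U_3,\,V_1\cup V_2\cup V_3\}.$$ -/

import Mathlib

/-- A clutter over a finite ground set: a family of subsets of the ground set, none of which
contains another one. -/
structure Clutter (α : Type*) where
  ground : Finset α
  members : Finset (Finset α)
  subset_ground : ∀ X ∈ members, X ⊆ ground
  antichain : ∀ X ∈ members, ∀ Y ∈ members, X ⊆ Y → X = Y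

namespace Clutter

section

variable {α β : Type*} [DecidableEq α]

/-- The inclusion-wise minimal sets of a family. -/
def minimalSets (F : Finset (Finset α)) : Finset (Finset α) :=
  F.filter (fun X => ∀ Y ∈ F, Y ⊆ X → Y = X)

/-- A cover: a subset of the ground set that intersects every member. -/
def IsCover (C : Clutter α) (B : Finset α) : Prop :=
  B ⊆ C.ground ∧ ∀ X ∈ C.members, (X ∩ B).Nonempty

instance (C : Clutter α) : DecidablePred C.IsCover := fun B =>
  inferInstanceAs (Decidable (B ⊆ C.ground ∧ ∀ X ∈ C.members, (X ∩ B).Nonempty))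

/-- The blocker `b(C)`: its members are the minimal covers of `C`. -/
def blocker (C : Clutter α) : Clutter α where
  ground := C.ground
  members := minimalSets (C.ground.powerset.filter C.IsCover)
  subset_ground := fun _ hX =>
    Finset.mem_powerset.1 (Finset.mem_filter.1 (Finset.mem_filter.1 hX).1).1
  antichain := fun X hX _ hY h =>
    (Finset.mem_filter.1 hY).2 X (Finset.mem_filter.1 hX).1 h

/-- The minor of `C` obtained after deleting `I` and contracting `J`
(used for disjoint subsets `I`, `J` of the ground set). -/
def minor (C : Clutter α) (I J : Finset α) : Clutter α where
  ground := C.ground \ (I ∪ J)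
  members := minimalSets ((C.members.filter (fun X => Disjoint X I)).image (fun X => X \ J))
  subset_ground := by
    intro X hX v hv
    obtain ⟨Y, hY, rfl⟩ := Finset.mem_image.1 (Finset.mem_filter.1 hX).1
    obtain ⟨hY1, hY2⟩ := Finset.mem_filter.1 hY
    obtain ⟨hvY, hvJ⟩ := Finset.mem_sdiff.1 hv
    refine Finset.mem_sdiff.2 ⟨C.subset_ground Y hY1 hvY, fun h => ?_⟩
    rcases Finset.mem_union.1 h with h | h
    · exact Finset.disjoint_left.1 hY2 hvY h
    · exact hvJ h
  antichain := fun X hX _ hY h =>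
    (Finset.mem_filter.1 hY).2 X (Finset.mem_filter.1 hX).1 h

/-- `D` is a minor of `C`. -/
def IsMinor (D C : Clutter α) : Prop :=
  ∃ I J : Finset α, I ⊆ C.ground ∧ J ⊆ C.ground ∧ Disjoint I J ∧ D = C.minor I J

/-- A delta: the ground set is `{a₁, …, aₙ}` with `n ≥ 3`, and the members are `{a₂, …, aₙ}` and
`{a₁, aᵢ}` for `i = 2, …, n`. -/
def IsDelta (C : Clutter α) : Prop :=
  3 ≤ C.ground.card ∧ ∃ a ∈ C.ground,
    C.members = insert (C.ground.erase a) ((C.ground.erase a).image (fun x => {a, x}))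

/-- An extended odd hole: the ground set is `{a₀, …, aₙ₋₁}` with `n ≥ 5` odd, and the members of
minimum cardinality are precisely `{a₀, a₁}, …, {aₙ₋₂, aₙ₋₁}, {aₙ₋₁, a₀}`. -/
def IsExtendedOddHole (C : Clutter α) : Prop :=
  ∃ (n : ℕ) (a : ℕ → α), 5 ≤ n ∧ Odd n ∧ Set.InjOn a (Set.Iio n) ∧
    C.ground = (Finset.range n).image a ∧
    C.members.filter (fun X => ∀ Y ∈ C.members, X.card ≤ Y.card) =
      (Finset.range n).image (fun i => {a i, a ((i + 1) % n)})

/-- A clutter is clean if it has no minor that is a delta or the blocker of an extended odd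
hole. -/
def IsClean (C : Clutter α) : Prop :=
  ∀ D : Clutter α, D.IsMinor C →
    ¬ D.IsDelta ∧ ¬ ∃ E : Clutter α, E.IsExtendedOddHole ∧ D = E.blocker

/-- The covering number `τ(C)`: the minimum cardinality of a cover (`⊤` if there is no cover). -/
noncomputable def coveringNumber (C : Clutter α) : ℕ∞ :=
  ⨅ (B : Finset α) (_ : C.IsCover B), (B.card : ℕ∞)

/-- A cover of minimum cardinality. -/
def IsMinimumCover (C : Clutter α) (B : Finset α) : Prop :=
  C.IsCover B ∧ (B.card : ℕ∞) = C.coveringNumber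

/-- A clutter is tangled if it has covering number two and every element belongs to a minimum
cover. -/
def IsTangled (C : Clutter α) : Prop :=
  C.coveringNumber = 2 ∧ ∀ v ∈ C.ground, ∃ B, C.IsMinimumCover B ∧ v ∈ B

/-- A fractional packing; only the values of `y` at the members of `C` matter. -/
def IsFractionalPacking (C : Clutter α) (y : Finset α → ℝ) : Prop :=
  (∀ X ∈ C.members, 0 ≤ y X) ∧ ∀ v ∈ C.ground, ∑ X ∈ C.members with v ∈ X, y X ≤ 1

open Classical in
/-- The core of `C`: the members that lie in the support of some fractional packing of value
two. -/
noncomputable def core (C : Clutter α) : Clutter α where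
  ground := C.ground
  members := C.members.filter (fun X =>
    ∃ y : Finset α → ℝ, C.IsFractionalPacking y ∧ ∑ Z ∈ C.members, y Z = 2 ∧ 0 < y X)
  subset_ground := fun X hX => C.subset_ground X (Finset.mem_filter.1 hX).1
  antichain := fun X hX Y hY h =>
    C.antichain X (Finset.mem_filter.1 hX).1 Y (Finset.mem_filter.1 hY).1 h

/-- The graph `G(C)` of a clutter `C` of covering number two: its vertices are the elements and its
edges are the minimum covers. -/
def graph (C : Clutter α) : SimpleGraph {v // v ∈ C.ground} where
  Adj u v := u ≠ v ∧ C.IsMinimumCover {u.1, v.1}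
  symm := ⟨fun u v h => ⟨h.1.symm, by rw [Finset.pair_comm]; exact h.2⟩⟩
  loopless := ⟨fun _ h => h.1 rfl⟩

/-- The rank: the number of connected components of `G(C)`. -/
noncomputable def rank (C : Clutter α) : ℕ := Nat.card C.graph.ConnectedComponent

/-- The connected components of `G(C)` can be listed as `c 0, …, c (r - 1)` (each exactly once) such
that `{U i, V i}` is a bipartition of the component `c i`: the disjoint sets `U i` and `V i`
together make up the vertex set of `c i`, and every edge of `c i` has one end in each of them. -/
def IsBipartitionList (C : Clutter α) {r : ℕ} (U V : Fin r → Finset α) : Prop :=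
  ∃ c : Fin r ≃ C.graph.ConnectedComponent, ∀ i : Fin r,
    (∀ v : α, v ∈ U i ∪ V i ↔
      ∃ h : v ∈ C.ground, C.graph.connectedComponentMk ⟨v, h⟩ = c i) ∧
    Disjoint (U i) (V i) ∧
    ∀ u v, C.graph.Adj u v → C.graph.connectedComponentMk u = c i →
      (u.1 ∈ U i ∧ v.1 ∈ V i) ∨ (u.1 ∈ V i ∧ v.1 ∈ U i)

/-- `C` is (up to relabeling the elements) a duplication of `D`: the map `f` sends each element of
`C` to the element of `D` of which it is a copy, and every element of `D` has at least one copy. -/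
def IsDuplicationOf (C : Clutter α) (D : Clutter β) : Prop :=
  ∃ f : {v // v ∈ C.ground} → {w // w ∈ D.ground}, Function.Surjective f ∧
    ∀ X ⊆ C.ground, X ∈ C.members ↔ ∃ Y ∈ D.members, ∀ v, v.1 ∈ X ↔ (f v).1 ∈ Y

end

/-- The cuboid of a set `S` of 0-1 points. The elements `2i-1` and `2i` of its ground set are here
written as `(i, 1)` and `(i, 0)`, so that the member of a point `p` contains `(i, 1)` if `p i = 1`
and `(i, 0)` if `1 - p i = 1`. -/
def cuboid {n : ℕ} (S : Finset (Fin n → Fin 2)) : Clutter (Fin n × Fin 2) where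
  ground := Finset.univ
  members := S.image (fun p => Finset.univ.filter (fun e : Fin n × Fin 2 => p e.1 = e.2))
  subset_ground := fun _ _ => Finset.subset_univ _
  antichain := by
    intro X hX Y hY h
    obtain ⟨p, _, rfl⟩ := Finset.mem_image.1 hX
    obtain ⟨q, _, rfl⟩ := Finset.mem_image.1 hY
    have hpq : p = q := by
      funext i
      have hi := h (Finset.mem_filter.2 ⟨Finset.mem_univ (i, p i), rfl⟩)
      exact (Finset.mem_filter.1 hi).2.symm
    rw [hpq]

section

variable {α : Type*} [DecidableEq α]

/-- `S` is a setcore of `C`: a set of points in `{0,1}^r`, where `r` is the rank of `C`, such that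
the core of `C` is a duplication of the cuboid of `S`. -/
def IsSetcore (C : Clutter α) {r : ℕ} (S : Finset (Fin r → Fin 2)) : Prop :=
  C.rank = r ∧ C.core.IsDuplicationOf (cuboid S)

/-- The setcore of `C` with respect to `(U 0, V 0; …; U (r - 1), V (r - 1))`: it has one point `p`
for each member `X` of the core, with `p i = 0` if and only if `X ∩ (U i ∪ V i) = U i`. -/
noncomputable def setcoreWrt (C : Clutter α) {r : ℕ} (U V : Fin r → Finset α) :
    Finset (Fin r → Fin 2) :=
  C.core.members.image (fun X i => if X ∩ (U i ∪ V i) = U i then 0 else 1)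

end

end Clutter

/-! The argument works with the upward closed family `F` of sets that meet every member. Deleting
`I` in the clutter corresponds to contracting `I` in `F`, and contracting `J` to restricting `F` to
sets avoiding `J`. A delta is its own blocker, so cleanness excludes deltas and odd cycles of
two-element covers (in the absence of one-element covers) from every contraction and restriction of
`F`.

Without one-element covers, a shortest odd closed walk of two-element covers would be a delta or an
odd hole, so the graph is bipartite. The heart of the proof is `IsPart.not_mem_family`: if `U`, `V`
are the sides of a component, no cover avoids `V` and has at most one element outside `U`. Hence
contracting `U` creates neither an empty nor a one-element cover, and the same facts apply after the
contraction. This shows that certain unions of sides, one from each component, are not covers.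

If such a union is not a cover, some member lies in its complement, which is the union of the
opposite sides; as a member meets every edge, it equals that complement. Rank one and rank two thus
give all transversals of sides as members. In rank three, contracting a side of one component leaves
two others that may become joined by an edge; either way one of the two diagonal pairs of
transversals consists of members. Absence of disjoint members excludes antipodal points, and the
choices for the two sides combine into one parity class.

Conversely, complementary slackness forces core members to meet each edge exactly once, hence to be
transversals. In each case the points of the transversals that are members are balanced in every
coordinate, so uniform weights form a packing of value two. Degree counting then determines all
setcores. -/

/-- The cover family of a clean clutter, abstractly: an upward closed family `F` of sets such that
no contraction and restriction inside `W` is the cover family of a delta or of the blocker of an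
extended odd hole. -/
structure CleanFamily {α : Type*} [DecidableEq α] (W : Finset α) (F : Finset α → Prop) : Prop where
  mono : ∀ A B : Finset α, A ⊆ B → F A → F B
  delta : ∀ (I L : Finset α) (a : α), I ⊆ W → L ⊆ W → a ∈ W → a ∉ L → a ∉ I → Disjoint L I →
    2 ≤ L.card → F (L ∪ I) → (∀ l ∈ L, ¬ F (L.erase l ∪ I)) →
    (∀ l ∈ L, F (insert a (insert l I))) → F (insert a I)
  hole : ∀ (I : Finset α) (n : ℕ) (a : ℕ → α), I ⊆ W → 5 ≤ n → Odd n →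
    Set.InjOn a (Set.Iio n) → (∀ i < n, a i ∈ W \ I) → (∀ i < n, ¬ F (insert (a i) I)) →
    ∃ i j, i < n ∧ j < n ∧ i ≠ j ∧
      ¬ (F (insert (a i) (insert (a j) I)) ↔ (j = (i + 1) % n ∨ i = (j + 1) % n))

/-- The graph on `W` whose edges are the two-element sets of `F`. -/
def pairGraph {α : Type*} [DecidableEq α] (W : Finset α) (F : Finset α → Prop) :
    SimpleGraph α where
  Adj u v := u ≠ v ∧ u ∈ W ∧ v ∈ W ∧ F {u, v}
  symm := ⟨fun u v h => ⟨h.1.symm, h.2.2.1, h.2.1, by rw [Finset.pair_comm]; exact h.2.2.2⟩⟩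
  loopless := ⟨fun _ h => h.1 rfl⟩

theorem SimpleGraph.Walk.exists_segment {V : Type*} {G : SimpleGraph V} {u v : V} (p : G.Walk u v)
    {i j : ℕ} (hij : i ≤ j) (hj : j ≤ p.length) :
    ∃ q : G.Walk (p.getVert i) (p.getVert j), q.length = j - i := by
  have h : (p.drop i).getVert (j - i) = p.getVert j := by
    rw [SimpleGraph.Walk.drop_getVert]; congr 1; omega
  refine ⟨((p.drop i).take (j - i)).copy rfl h, ?_⟩
  rw [SimpleGraph.Walk.length_copy, SimpleGraph.Walk.take_length, SimpleGraph.Walk.drop_length]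
  omega

/-! ### Odd closed walks and exchange in clean families -/

namespace CleanFamily

variable {α : Type*} [DecidableEq α] {W : Finset α} {F : Finset α → Prop}

/-- Excluded configurations in a contraction by `I` are excluded configurations of `F` with `I`
added to the contracted set. -/
theorem minor (h : CleanFamily W F) {I W' : Finset α} (hI : I ⊆ W) (hW' : W' ⊆ W)
    (hd : Disjoint W' I) : CleanFamily W' (fun Y => F (Y ∪ I)) where
  mono A B hAB hA := h.mono _ _ (Finset.union_subset_union_left hAB) hA
  delta I' L a hI' hL ha haL haI' hLI' hc h1 h2 h3 := by
    simp only [Finset.insert_union, Finset.union_assoc] at *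
    refine h.delta (I' ∪ I) L a (Finset.union_subset (hI'.trans hW') hI) (hL.trans hW') (hW' ha)
      haL ?_ ?_ hc h1 h2 h3
    · simp only [Finset.mem_union, not_or]
      exact ⟨haI', fun hh => Finset.disjoint_left.1 hd ha hh⟩
    · exact Finset.disjoint_union_right.2 ⟨hLI', Finset.disjoint_of_subset_left hL hd⟩
  hole I' n a hI' hn hodd hinj ha hs := by
    simp only [Finset.insert_union] at *
    refine h.hole (I' ∪ I) n a (Finset.union_subset (hI'.trans hW') hI) hn hodd hinj ?_ hs
    intro i hi
    have := Finset.mem_sdiff.1 (ha i hi)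
    simp only [Finset.mem_sdiff, Finset.mem_union, not_or]
    exact ⟨hW' this.1, this.2, fun hh => Finset.disjoint_left.1 hd this.1 hh⟩

/-- A shortest odd closed walk is an induced cycle. Of length three it is a delta, of length at
least five an odd hole, and both are excluded. -/
theorem walk_length_ne (h : CleanFamily W F) (hs : ∀ v ∈ W, ¬ F {v}) (n : ℕ) (hn : Odd n) :
    ∀ (v : α) (p : (pairGraph W F).Walk v v), p.length ≠ n := by
  induction n using Nat.strong_induction_on with
  | _ n ih =>
  intro v p hp
  have hadj : ∀ i < n, (pairGraph W F).Adj (p.getVert i) (p.getVert (i + 1)) :=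
    fun i hi => p.adj_getVert_succ (hp ▸ hi)
  have hlast : p.getVert n = p.getVert 0 := by rw [← hp]; simp
  have hW : ∀ i < n, p.getVert i ∈ W := fun i hi => (hadj i hi).2.1
  -- A repeated vertex or a chord splits the closed walk in two; parity makes one piece odd, and it
  -- is shorter than `n`. The bounds keep `i` and `j` at cyclic distance at least two.
  have hshort : ∀ i j, i + 2 ≤ j → j ≤ n → j - i + 2 ≤ n →
      p.getVert i ≠ p.getVert j ∧ ¬ (pairGraph W F).Adj (p.getVert i) (p.getVert j) := by
    intro i j hij hj hji
    obtain ⟨q, hq⟩ := p.exists_segment (i := i) (j := j) (by omega) (by omega)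
    obtain ⟨q1, hq1⟩ := p.exists_segment (i := 0) (j := i) (by omega) (by omega)
    obtain ⟨q2, hq2⟩ := p.exists_segment (i := j) (j := n) (by omega) (by omega)
    constructor
    · intro he
      rcases Nat.even_or_odd (j - i) with hev | hodd
      · have hodd' : Odd (n - (j - i)) := Nat.Odd.sub_even (by omega) hn hev
        refine ih _ (by omega) hodd' _
          (q1.append ((q2.copy he.symm hlast))) ?_
        simp only [SimpleGraph.Walk.length_append, SimpleGraph.Walk.length_copy]; omega
      · exact ih _ (by omega) hodd _ (q.copy rfl he.symm) (by simpa using hq)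
    · intro he
      rcases Nat.even_or_odd (j - i) with hev | hodd
      · exact ih (j - i + 1) (by omega) hev.add_one _ (SimpleGraph.Walk.cons he.symm q)
          (by simp [hq])
      · have hodd' : Odd (n - (j - i) + 1) := (Nat.Odd.sub_odd hn hodd).add_one
        by_cases hlt : n - (j - i) + 1 < n
        · refine ih _ hlt hodd' _
            (q1.append (SimpleGraph.Walk.cons he (q2.copy rfl hlast))) ?_
          simp only [SimpleGraph.Walk.length_append, SimpleGraph.Walk.length_cons,
            SimpleGraph.Walk.length_copy]
          omega
        · omega
  have hinj : Set.InjOn p.getVert (Set.Iio n) := by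
    have key : ∀ i j, i < j → j < n → p.getVert i ≠ p.getVert j := by
      intro i j hij hj
      rcases Nat.lt_or_ge (i + 1) j with h1 | h1
      · rcases Nat.lt_or_ge n (j - i + 2) with h2 | h2
        · have hi : i = 0 := by omega
          have hj' : j + 1 = n := by omega
          have := (hadj j hj).ne
          rw [hj', hlast] at this
          rw [hi]; exact this.symm
        · exact (hshort i j h1 hj.le h2).1
      · have : j = i + 1 := by omega
        rw [this]; exact (hadj i (by omega)).ne
    intro i hi j hj he
    rcases Nat.lt_trichotomy i j with h1 | h1 | h1
    · exact absurd he (key i j h1 hj)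
    · exact h1
    · exact absurd he.symm (key j i h1 hi)
  have hn2 : n ≠ 1 := by
    rintro rfl
    exact (hadj 0 (by omega)).ne hlast.symm
  rcases Nat.lt_or_ge n 5 with h5 | h5
  · have h3 : n = 3 := by
      obtain ⟨k, rfl⟩ := hn; omega
    subst h3
    have n01 := (hadj 0 (by omega)).ne
    have n12 := (hadj 1 (by omega)).ne
    have h20 := hadj 2 (by omega)
    rw [hlast] at h20
    have h01 := (hadj 0 (by omega)).2.2.2
    have h12 := (hadj 1 (by omega)).2.2.2
    -- A triangle is a three-element delta, and its exclusion would make vertex 0 a one-element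
    -- cover.
    have key := h.delta ∅ {p.getVert 1, p.getVert 2} (p.getVert 0) (by simp)
      (by simp [Finset.insert_subset_iff, hW]) (hW 0 (by omega))
      (by rw [Finset.mem_insert, Finset.mem_singleton, not_or]; exact ⟨n01, h20.ne.symm⟩) (by simp) (by simp)
      (by rw [Finset.card_pair n12]) (by simpa using h12) ?_ ?_
    · exact hs _ (hW 0 (by omega)) (by simpa using key)
    · intro l hl hF
      simp only [Finset.mem_insert, Finset.mem_singleton] at hl
      rcases hl with rfl | rfl
      · refine hs _ (hW 2 (by omega)) (h.mono _ _ ?_ hF)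
        intro x; simp +contextual
      · refine hs _ (hW 1 (by omega)) (h.mono _ _ ?_ hF)
        intro x; simp; tauto
    · intro l hl
      simp only [Finset.mem_insert, Finset.mem_singleton] at hl
      rcases hl with rfl | rfl
      · simpa using h01
      · have := h20.symm.2.2.2
        simpa using this
  · obtain ⟨i, j, hi, hj, hij, hne⟩ := h.hole ∅ n p.getVert (by simp) h5 hn hinj
      (fun i hi => by simpa using hW i hi) (fun i hi => by simpa using hs _ (hW i hi))
    have key : ∀ i j, i < j → j < n →
        ((F {p.getVert i, p.getVert j}) ↔ (j = (i + 1) % n ∨ i = (j + 1) % n)) := by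
      intro i j hij hj
      constructor
      · intro hF
        by_contra hcon
        rw [Nat.mod_eq_of_lt (show i + 1 < n by omega), not_or] at hcon
        have hne : p.getVert i ≠ p.getVert j :=
          fun he => hij.ne (hinj (show i < n by omega) hj he)
        refine (hshort i j (by omega) (by omega) ?_).2
          ⟨hne, hW i (by omega), hW j hj, hF⟩
        by_contra hlt
        have : j + 1 = n := by omega
        rw [this, Nat.mod_self] at hcon
        omega
      · rintro (he | he)
        · rw [Nat.mod_eq_of_lt (show i + 1 < n by omega)] at he
          rw [he]; exact (hadj i (by omega)).2.2.2
        · rcases Nat.lt_or_ge (j + 1) n with h1 | h1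
          · rw [Nat.mod_eq_of_lt h1] at he; omega
          · have h2 : j + 1 = n := by omega
            rw [h2, Nat.mod_self] at he
            have := hadj j hj
            rw [h2, hlast] at this
            rw [he]; exact this.symm.2.2.2
    apply hne
    rcases Nat.lt_or_gt_of_ne hij with h1 | h1
    · simpa using key i j h1 hj
    · have := key j i h1 hi
      rw [Finset.pair_comm] at this
      rw [or_comm]
      simpa using this

/-- Take `I` maximal with `T ⊆ I ⊆ X` and `insert p I` outside `F`. If `X \ I` had two elements,
contracting `I` would expose a delta with apex `p` and long member `X \ I`. So `X \ I` is a single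
element, the required `y`. -/
theorem exists_extension (h : CleanFamily W F) {X : Finset α} (hX : X ⊆ W) (hFX : F X)
    (hmin : ∀ y ∈ X, ¬ F (X.erase y)) {p : α} (hp : p ∈ W) (hpX : p ∉ X) {T : Finset α}
    (hT : T ⊆ X) (hFT : ¬ F (insert p T)) :
    ∃ y ∈ X, y ∉ T ∧ ¬ F (insert p (X.erase y)) := by
  classical
  obtain ⟨I, hI, hImax⟩ := (X.powerset.filter (fun I => T ⊆ I ∧ ¬ F (insert p I))).exists_maximal
    ⟨T, by simp [hT, hFT]⟩
  simp only [Finset.mem_filter, Finset.mem_powerset] at hI hImax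
  obtain ⟨hIX, hTI, hFI⟩ := hI
  have hmax : ∀ l ∈ X \ I, F (insert p (insert l I)) := by
    intro l hl
    by_contra hF
    have hl' := Finset.mem_sdiff.1 hl
    have := hImax (y := insert l I)
      ⟨Finset.insert_subset hl'.1 hIX, hTI.trans (Finset.subset_insert _ _), hF⟩
      (Finset.subset_insert _ _)
    exact hl'.2 (this (Finset.mem_insert_self _ _))
  have hne : (X \ I).Nonempty := by
    rw [Finset.sdiff_nonempty]
    intro hXI
    exact hFI (h.mono _ _ (hXI.trans (Finset.subset_insert _ _)) hFX)
  have hcard : (X \ I).card < 2 := by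
    by_contra hc
    refine hFI (h.delta I (X \ I) p (hIX.trans hX) (Finset.sdiff_subset.trans hX) hp
      (fun hh => hpX (Finset.mem_sdiff.1 hh).1) (fun hh => hpX (hIX hh)) Finset.sdiff_disjoint
      (by omega) ?_ ?_ hmax)
    · rwa [Finset.sdiff_union_of_subset hIX]
    · intro l hl hF
      have hl' := Finset.mem_sdiff.1 hl
      refine hmin l hl'.1 (h.mono _ _ ?_ hF)
      intro x hx
      simp only [Finset.mem_union, Finset.mem_erase, Finset.mem_sdiff] at hx ⊢
      rcases hx with hx | hx
      · exact ⟨hx.1, hx.2.1⟩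
      · exact ⟨fun he => hl'.2 (he ▸ hx), hIX hx⟩
  have : (X \ I).card = 1 := by have := hne.card_pos; omega
  obtain ⟨y, hy⟩ := Finset.card_eq_one.1 this
  have hyI : y ∈ X \ I := by rw [hy]; simp
  have hyI' := Finset.mem_sdiff.1 hyI
  refine ⟨y, hyI'.1, fun hh => hyI'.2 (hTI hh), fun hF => hFI (h.mono _ _ ?_ hF)⟩
  refine Finset.insert_subset_insert _ ?_
  intro x hx
  by_contra hxI
  have : x ∈ X \ I := Finset.mem_sdiff.2 ⟨(Finset.mem_erase.1 hx).2, hxI⟩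
  rw [hy, Finset.mem_singleton] at this
  exact (Finset.mem_erase.1 hx).1 this

end CleanFamily

/-! ### Sides of a component are not covers -/

/-- `U`, `V` are the two sides of a connected component of `pairGraph W F`. -/
structure IsPart {α : Type*} [DecidableEq α] (W : Finset α) (F : Finset α → Prop)
    (U V : Finset α) : Prop where
  disj : Disjoint U V
  subset : U ∪ V ⊆ W
  reachable : ∀ u ∈ U ∪ V, ∀ v ∈ U ∪ V, (pairGraph W F).Reachable u v
  alt : ∀ u v, (pairGraph W F).Adj u v → u ∈ U ∪ V → (u ∈ U ∧ v ∈ V) ∨ (u ∈ V ∧ v ∈ U)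

theorem pairGraph_exists_walk {α : Type*} [DecidableEq α] {W W' : Finset α}
    {F F' : Finset α → Prop} (hF : ∀ u v, F {u, v} → F' {u, v}) {u v : α}
    (p : (pairGraph W F).Walk u v) (hp : ∀ x ∈ p.support, x ∈ W') :
    ∃ q : (pairGraph W' F').Walk u v, q.length = p.length := by
  induction p with
  | nil => exact ⟨SimpleGraph.Walk.nil, rfl⟩
  | @cons a b c h p ih =>
    obtain ⟨q, hq⟩ := ih (fun x hx => hp x (by simp [hx]))
    have hab : (pairGraph W' F').Adj a b :=
      ⟨h.1, hp a (by simp), hp b (by simp), hF _ _ h.2.2.2⟩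
    exact ⟨SimpleGraph.Walk.cons hab q, by simp [hq]⟩

/-- Contract `X` minus `x` and `z`. The hypotheses exclude one-element covers on the walk and at
`z`, while `{t, z}` and `{z, x}` become edges. These two edges close the odd walk from `x` to `t`
into an odd closed walk. -/
theorem CleanFamily.not_odd_walk {α : Type*} [DecidableEq α] {W : Finset α}
    {F : Finset α → Prop} (hF : CleanFamily W F) {X : Finset α} (hX : X ⊆ W) (hFX : F X)
    (hmin : ∀ y ∈ X, ¬ F (X.erase y)) {x z t : α} (hxX : x ∈ X) (hzX : z ∈ X) (hzx : z ≠ x)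
    (htW : t ∈ W) (htX : t ∉ X) (hFx : F (insert t (X.erase x)))
    (hFz : ¬ F (insert t (X.erase z))) (p : (pairGraph W F).Walk x t) (hp : Odd p.length)
    (hsupp : ∀ v ∈ p.support, v = x ∨ v = t ∨
      (v ∈ W ∧ v ∉ X ∧ ¬ F (insert v (X.erase x)))) : False := by
  obtain ⟨I, hI⟩ : ∃ I, I = (X.erase x).erase z := ⟨_, rfl⟩
  obtain ⟨W₀, hW₀⟩ : ∃ W₀, W₀ = insert z p.support.toFinset := ⟨_, rfl⟩
  have hmemI : ∀ y, y ∈ I ↔ y ≠ z ∧ y ≠ x ∧ y ∈ X := by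
    intro y; rw [hI, Finset.mem_erase, Finset.mem_erase]
  have hpW₀ : ∀ v ∈ p.support, v ∈ W₀ := fun v hv => by
    rw [hW₀]; exact Finset.mem_insert_of_mem (List.mem_toFinset.2 hv)
  have hcases : ∀ v ∈ W₀, v = z ∨ v = x ∨ v = t ∨
      (v ∈ W ∧ v ∉ X ∧ ¬ F (insert v (X.erase x))) := by
    intro v hv
    rw [hW₀] at hv
    rcases Finset.mem_insert.1 hv with hv | hv
    · exact Or.inl hv
    · exact Or.inr (hsupp v (List.mem_toFinset.1 hv))
  have hW₀W : W₀ ⊆ W := by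
    intro v hv
    rcases hcases v hv with rfl | rfl | rfl | hv
    · exact hX hzX
    · exact hX hxX
    · exact htW
    · exact hv.1
  have hIX : I ⊆ X := fun y hy => ((hmemI y).1 hy).2.2
  have hdisj : Disjoint W₀ I := by
    rw [Finset.disjoint_left]
    intro v hv hvI
    rw [hmemI] at hvI
    rcases hcases v hv with hv | hv | rfl | hv
    · exact hvI.1 hv
    · exact hvI.2.1 hv
    · exact htX hvI.2.2
    · exact hv.2.1 hvI.2.2
  have hminor := hF.minor (hIX.trans hX) hW₀W hdisj
  have hsub : ∀ (v : α) (Y : Finset α), v ∈ Y → (∀ y ∈ X, y ≠ z → y ≠ x → y ∈ Y) →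
      F ({v} ∪ I) → F Y := by
    intro v Y hv hY
    refine hF.mono _ _ ?_
    intro y hy
    rcases Finset.mem_union.1 hy with hy | hy
    · rwa [Finset.mem_singleton.1 hy]
    · rw [hmemI] at hy
      exact hY y hy.2.2 hy.1 hy.2.1
  have hsing : ∀ v ∈ W₀, ¬ F ({v} ∪ I) := by
    intro v hv hFv
    rcases hcases v hv with rfl | rfl | rfl | hv
    · exact hmin x hxX (hsub _ _ (Finset.mem_erase.2 ⟨hzx, hzX⟩)
        (fun y hy _ h2 => Finset.mem_erase.2 ⟨h2, hy⟩) hFv)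
    · exact hmin z hzX (hsub _ _ (Finset.mem_erase.2 ⟨hzx.symm, hxX⟩)
        (fun y hy h1 _ => Finset.mem_erase.2 ⟨h1, hy⟩) hFv)
    · exact hFz (hsub _ _ (Finset.mem_insert_self _ _)
        (fun y hy h1 _ => Finset.mem_insert_of_mem (Finset.mem_erase.2 ⟨h1, hy⟩)) hFv)
    · exact hv.2.2 (hsub _ _ (Finset.mem_insert_self _ _)
        (fun y hy _ h2 => Finset.mem_insert_of_mem (Finset.mem_erase.2 ⟨h2, hy⟩)) hFv)
  obtain ⟨q, hq⟩ := pairGraph_exists_walk (W' := W₀) (F' := fun Y => F (Y ∪ I))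
    (fun u v huv => hF.mono _ _ Finset.subset_union_left huv) p hpW₀
  have hzW₀ : z ∈ W₀ := by rw [hW₀]; exact Finset.mem_insert_self _ _
  have hxW₀ : x ∈ W₀ := hpW₀ x p.start_mem_support
  have htW₀ : t ∈ W₀ := hpW₀ t p.end_mem_support
  have hzx_adj : (pairGraph W₀ (fun Y => F (Y ∪ I))).Adj z x := by
    refine ⟨hzx, hzW₀, hxW₀, hF.mono _ _ ?_ hFX⟩
    intro y hy
    simp only [hmemI, Finset.mem_union, Finset.mem_singleton, Finset.mem_insert]
    tauto
  have htz_adj : (pairGraph W₀ (fun Y => F (Y ∪ I))).Adj t z := by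
    refine ⟨fun he => htX (he ▸ hzX), htW₀, hzW₀, hF.mono _ _ ?_ hFx⟩
    intro y hy
    simp only [hmemI, Finset.mem_union, Finset.mem_singleton, Finset.mem_erase,
      Finset.mem_insert] at hy ⊢
    tauto
  refine hminor.walk_length_ne hsing (p.length + 2) (hp.add_even (by decide)) x
    (q.append (SimpleGraph.Walk.cons htz_adj (SimpleGraph.Walk.cons hzx_adj
      SimpleGraph.Walk.nil))) ?_
  simp [hq]

namespace IsPart

variable {α : Type*} [DecidableEq α] {W : Finset α} {F : Finset α → Prop} {U V : Finset α}

theorem symm (h : IsPart W F U V) : IsPart W F V U where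
  disj := h.disj.symm
  subset := by rw [Finset.union_comm]; exact h.subset
  reachable := by rw [Finset.union_comm]; exact h.reachable
  alt u v huv hu := (h.alt u v huv (by rwa [Finset.union_comm])).symm

theorem walk_parity (h : IsPart W F U V) {u v : α} (p : (pairGraph W F).Walk u v) :
    (u ∈ U → (Even p.length → v ∈ U) ∧ (Odd p.length → v ∈ V)) ∧
    (u ∈ V → (Even p.length → v ∈ V) ∧ (Odd p.length → v ∈ U)) := by
  induction p with
  | nil => simp
  | @cons a b c hab p ih =>
    rw [SimpleGraph.Walk.length_cons, Nat.even_add_one, Nat.odd_add_one,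
      Nat.not_even_iff_odd, Nat.not_odd_iff_even]
    constructor
    · intro ha
      have hb : b ∈ V := by
        rcases h.alt a b hab (Finset.mem_union_left _ ha) with hh | hh
        · exact hh.2
        · exact absurd hh.1 (Finset.disjoint_left.1 h.disj ha)
      exact ⟨(ih.2 hb).2, (ih.2 hb).1⟩
    · intro ha
      have hb : b ∈ U := by
        rcases h.alt a b hab (Finset.mem_union_right _ ha) with hh | hh
        · exact absurd ha (Finset.disjoint_left.1 h.disj hh.1)
        · exact hh.2
      exact ⟨(ih.1 hb).2, (ih.1 hb).1⟩

theorem walk_mem (h : IsPart W F U V) {u v : α} (p : (pairGraph W F).Walk u v)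
    (hu : u ∈ U ∪ V) : v ∈ U ∪ V := by
  have := h.walk_parity p
  rcases Nat.even_or_odd p.length with hp | hp <;> rcases Finset.mem_union.1 hu with hu | hu <;>
    simp_all

theorem walk_support_mem (h : IsPart W F U V) {u v : α} (p : (pairGraph W F).Walk u v)
    (hu : u ∈ U ∪ V) : ∀ x ∈ p.support, x ∈ U ∪ V := by
  intro x hx
  exact h.walk_mem (p.takeUntil x hx) hu

theorem even_of_mem (h : IsPart W F U V) {u v : α} (p : (pairGraph W F).Walk u v)
    (hu : u ∈ U) (hv : v ∈ U) : Even p.length := by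
  by_contra hodd
  exact Finset.disjoint_left.1 h.disj hv
    (((h.walk_parity p).1 hu).2 (Nat.not_even_iff_odd.1 hodd))

/-- Take a counterexample `X` of minimum size with two elements of `X ∩ U` joined by a walk that is
as short as possible over all such `X`. Walking from `x`, stop at the first vertex that lies in `X`
or can replace `x` in `X`. If it is in `U`, it yields a shorter walk; if in `V`, it yields the
configuration excluded by `not_odd_walk`. The one element allowed outside `U` is what makes
contracting `U` safe later. -/
theorem not_mem_family (h : IsPart W F U V) (hF : CleanFamily W F) (h0 : ¬ F ∅)
    (hs : ∀ v ∈ W, ¬ F {v}) (X : Finset α) (hX : X ⊆ W) (hFX : F X) (hXV : Disjoint X V)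
    (hXU : (X \ U).card ≤ 1) : False := by
  classical
  let P : Finset α → Prop := fun X => X ⊆ W ∧ F X ∧ Disjoint X V ∧ (X \ U).card ≤ 1
  have hex : ∃ k, ∃ X, P X ∧ X.card = k := ⟨_, X, ⟨hX, hFX, hXV, hXU⟩, rfl⟩
  obtain ⟨k, ⟨X₀, hPX₀, hX₀k⟩, hkmin⟩ :
      ∃ k, (∃ X, P X ∧ X.card = k) ∧ ∀ Y, P Y → k ≤ Y.card :=
    ⟨Nat.find hex, Nat.find_spec hex, fun Y hY => Nat.find_min' hex ⟨Y, hY, rfl⟩⟩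
  -- Otherwise `X` has at most two elements. The only open case is an edge with an end in `U`, whose
  -- other end is then in `V`.
  have htwo : ∀ X, P X → 2 ≤ (X ∩ U).card := by
    intro X hPX
    obtain ⟨hX, hFX, hXV, hXU⟩ := hPX
    have hcard := Finset.card_sdiff_add_card_inter X U
    by_contra hlt
    have hX2 : X.card ≤ 2 := by omega
    interval_cases hc : X.card
    · rw [Finset.card_eq_zero.1 hc] at hFX; exact h0 hFX
    · obtain ⟨x, rfl⟩ := Finset.card_eq_one.1 hc
      exact hs x (hX (by simp)) hFX
    · obtain ⟨x, y, hxy, rfl⟩ := Finset.card_eq_two.1 hc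
      have hne : (({x, y} : Finset α) ∩ U).Nonempty := by
        rw [← Finset.card_pos]; omega
      obtain ⟨z, hz⟩ := hne
      simp only [Finset.mem_inter, Finset.mem_insert, Finset.mem_singleton] at hz
      obtain ⟨hz1, hzU⟩ := hz
      have hadj : (pairGraph W F).Adj x y := ⟨hxy, hX (by simp), hX (by simp), hFX⟩
      have hz' : ∃ t ∈ ({x, y} : Finset α), t ∈ V := by
        rcases hz1 with rfl | rfl
        · rcases h.alt _ _ hadj (Finset.mem_union_left _ hzU) with hh | hh
          · exact ⟨y, by simp, hh.2⟩
          · exact ⟨z, by simp, hh.1⟩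
        · rcases h.alt _ _ hadj.symm (Finset.mem_union_left _ hzU) with hh | hh
          · exact ⟨x, by simp, hh.2⟩
          · exact ⟨z, by simp, hh.1⟩
      obtain ⟨t, ht, htV⟩ := hz'
      exact Finset.disjoint_left.1 hXV ht htV
  let Q : ℕ → Prop := fun m => ∃ (X : Finset α) (x x' : α) (p : (pairGraph W F).Walk x x'),
    P X ∧ X.card = k ∧ x ∈ X ∧ x ∈ U ∧ x' ∈ X ∧ x' ∈ U ∧ x ≠ x' ∧ p.length = m
  have hQex : ∃ m, Q m := by
    obtain ⟨x, hx, x', hx', hne⟩ := Finset.one_lt_card.1 (htwo X₀ hPX₀)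
    rw [Finset.mem_inter] at hx hx'
    obtain ⟨p⟩ := h.reachable x (Finset.mem_union_left _ hx.2) x' (Finset.mem_union_left _ hx'.2)
    exact ⟨_, X₀, x, x', p, hPX₀, hX₀k, hx.1, hx.2, hx'.1, hx'.2, hne, rfl⟩
  obtain ⟨m, ⟨X, x, x', p, hPX, hXk, hxX, hxU, hx'X, hx'U, hxx', hpm⟩, hmmin⟩ :
      ∃ m, Q m ∧ ∀ m', Q m' → m ≤ m' :=
    ⟨Nat.find hQex, Nat.find_spec hQex, fun m' hm' => Nat.find_min' hQex hm'⟩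
  obtain ⟨hX, hFX, hXV, hXU⟩ := hPX
  have hmin : ∀ y ∈ X, ¬ F (X.erase y) := by
    intro y hy hFy
    have := hkmin (X.erase y) ⟨(Finset.erase_subset _ _).trans hX, hFy,
      Finset.disjoint_of_subset_left (Finset.erase_subset _ _) hXV,
      (Finset.card_le_card (Finset.sdiff_subset_sdiff (Finset.erase_subset _ _)
        (Finset.Subset.refl _))).trans hXU⟩
    have h2 := Finset.card_erase_lt_of_mem hy
    omega
  have hmeven : Even m := hpm ▸ h.even_of_mem p hxU hx'U
  have hm0 : m ≠ 0 := by
    rintro rfl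
    exact hxx' (SimpleGraph.Walk.eq_of_length_eq_zero hpm)
  have hpU : ∀ i ≤ m, Even i → p.getVert i ∈ U := by
    intro i hi hev
    have hl : (p.take i).length = i := by rw [SimpleGraph.Walk.take_length]; omega
    exact ((h.walk_parity (p.take i)).1 hxU).1 (by rwa [hl])
  have hpV : ∀ i ≤ m, Odd i → p.getVert i ∈ V := by
    intro i hi hev
    have hl : (p.take i).length = i := by rw [SimpleGraph.Walk.take_length]; omega
    exact ((h.walk_parity (p.take i)).1 hxU).2 (by rwa [hl])
  have hpW : ∀ i ≤ m, p.getVert i ∈ W := by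
    intro i hi
    rcases Nat.even_or_odd i with hh | hh
    · exact h.subset (Finset.mem_union_left _ (hpU i hi hh))
    · exact h.subset (Finset.mem_union_right _ (hpV i hi hh))
  let R : ℕ → Prop := fun j => 1 ≤ j ∧ (p.getVert j ∈ X ∨ F (insert (p.getVert j) (X.erase x)))
  -- The last vertex before `x'` forms an edge with `x'`, and `x'` survives in `X.erase x`; so the
  -- stopping index exists and is below `m`.
  have hR : R (m - 1) := by
    have hm2 : 2 ≤ m := by
      obtain ⟨c, hc⟩ := hmeven
      omega
    refine ⟨by omega, Or.inr ?_⟩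
    have hadj := p.adj_getVert_succ (i := m - 1) (by omega)
    have hx'm : p.getVert (m - 1 + 1) = x' := by
      rw [show m - 1 + 1 = p.length by omega]; simp
    rw [hx'm] at hadj
    refine hF.mono _ _ ?_ hadj.2.2.2
    exact Finset.insert_subset_insert _
      (Finset.singleton_subset_iff.2 (Finset.mem_erase.2 ⟨hxx'.symm, hx'X⟩))
  have hRex : ∃ j, R j := ⟨_, hR⟩
  obtain ⟨j, ⟨hj1, hj⟩, hjmin⟩ : ∃ j, R j ∧ ∀ i, R i → j ≤ i :=
    ⟨Nat.find hRex, Nat.find_spec hRex, fun m' hm' => Nat.find_min' hRex hm'⟩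
  have hjm : j < m := by have := hjmin _ hR; omega
  have htakel : (p.take j).length = j := by rw [SimpleGraph.Walk.take_length]; omega
  have hdropl : (p.drop j).length = m - j := by rw [SimpleGraph.Walk.drop_length]; omega
  have hdrop : ∀ Y, P Y → Y.card = k → p.getVert j ∈ Y → p.getVert j ∈ U → x' ∈ Y →
      p.getVert j ≠ x' → False := by
    intro Y hY1 hY2 hY3 hY4 hY5 hY6
    have := hmmin (m - j) ⟨Y, _, x', p.drop j, hY1, hY2, hY3, hY4, hY5, hx'U, hY6, hdropl⟩
    omega
  -- If the stopping vertex were in `X ∩ U`, the initial or the final segment of the walk would join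
  -- two distinct elements of `X ∩ U` and be shorter.
  have hjX' : p.getVert j ∈ U → p.getVert j ∉ X := by
    intro hjU hjX
    by_cases he : p.getVert j = x
    · exact hdrop X ⟨hX, hFX, hXV, hXU⟩ hXk hjX hjU hx'X (by rw [he]; exact hxx')
    · have := hmmin j ⟨X, x, _, p.take j, ⟨hX, hFX, hXV, hXU⟩, hXk, hxX, hxU, hjX, hjU,
        fun hh => he hh.symm, htakel⟩
      omega
  have hjodd : Odd j := by
    by_contra hev
    rw [Nat.not_odd_iff_even] at hev
    have hjU := hpU j hjm.le hev
    have hjX := hjX' hjU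
    have hFj := hj.resolve_left hjX
    -- Replacing `x` by the stopping vertex keeps the size minimum, and the rest of the walk to `x'`
    -- is shorter.
    refine hdrop (insert (p.getVert j) (X.erase x)) ⟨?_, hFj, ?_, ?_⟩ ?_
      (Finset.mem_insert_self _ _) hjU
      (Finset.mem_insert_of_mem (Finset.mem_erase.2 ⟨hxx'.symm, hx'X⟩))
      (fun he => hjX (by rw [he]; exact hx'X))
    · exact Finset.insert_subset (hpW j hjm.le) ((Finset.erase_subset _ _).trans hX)
    · rw [Finset.disjoint_insert_left]
      exact ⟨Finset.disjoint_left.1 h.disj hjU,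
        Finset.disjoint_of_subset_left (Finset.erase_subset _ _) hXV⟩
    · rw [Finset.insert_sdiff_of_mem _ hjU]
      exact (Finset.card_le_card (Finset.sdiff_subset_sdiff (Finset.erase_subset _ _)
        (Finset.Subset.refl _))).trans hXU
    · rw [Finset.card_insert_of_notMem (fun hh => hjX (Finset.mem_erase.1 hh).2),
        Finset.card_erase_add_one hxX, hXk]
  have hjV := hpV j hjm.le hjodd
  have hjX : p.getVert j ∉ X := fun hh => Finset.disjoint_left.1 hXV hh hjV
  have hFj := hj.resolve_left hjX
  -- With `T` empty the hypothesis needed is just that the stopping vertex is not a one-element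
  -- cover.
  obtain ⟨z, hzX, -, hFz⟩ := hF.exists_extension hX hFX hmin (hpW j hjm.le) hjX
    (Finset.empty_subset X) (by simpa using hs _ (hpW j hjm.le))
  have hzx : z ≠ x := by rintro rfl; exact hFz hFj
  refine hF.not_odd_walk hX hFX hmin hxX hzX hzx (hpW j hjm.le) hjX hFj hFz (p.take j)
    (by rwa [htakel]) ?_
  intro v hv
  obtain ⟨i, hi, -⟩ := SimpleGraph.Walk.mem_support_iff_exists_getVert.1 hv
  rw [SimpleGraph.Walk.take_getVert] at hi
  subst hi
  rcases Nat.eq_zero_or_pos i with rfl | hi0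
  · simp
  · rcases Nat.lt_or_ge i j with hij | hij
    · rw [show j ⊓ i = i by omega]
      refine Or.inr (Or.inr ⟨hpW i (by omega), ?_⟩)
      rw [← not_or]
      intro hh
      have := hjmin i ⟨hi0, hh⟩
      omega
    · rw [show j ⊓ i = j by omega]; simp

end IsPart

/-! ### Contracting a side: two and three components -/

namespace IsPart

variable {α : Type*} [DecidableEq α] {W : Finset α} {F : Finset α → Prop} {U V : Finset α}

theorem not_family_left (h : IsPart W F U V) (hF : CleanFamily W F) (h0 : ¬ F ∅)
    (hs : ∀ v ∈ W, ¬ F {v}) : ¬ F U := fun hU =>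
  h.not_mem_family hF h0 hs U (Finset.subset_union_left.trans h.subset) hU h.disj (by simp)

theorem contract (h : IsPart W F U V) (hF : CleanFamily W F) (h0 : ¬ F ∅)
    (hs : ∀ v ∈ W, ¬ F {v}) {W' : Finset α} (hW' : W' ⊆ W) (hd : Disjoint W' (U ∪ V)) :
    CleanFamily W' (fun Y => F (Y ∪ U)) ∧ ¬ F (∅ ∪ U) ∧ ∀ v ∈ W', ¬ F ({v} ∪ U) := by
  have hU : U ⊆ W := Finset.subset_union_left.trans h.subset
  refine ⟨hF.minor hU hW' (Finset.disjoint_of_subset_right Finset.subset_union_left hd), ?_, ?_⟩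
  · rw [Finset.empty_union]; exact h.not_family_left hF h0 hs
  · intro v hv hFv
    have hvUV := Finset.disjoint_left.1 hd hv
    refine h.not_mem_family hF h0 hs _
      (Finset.union_subset (Finset.singleton_subset_iff.2 (hW' hv)) hU) hFv ?_ ?_
    · rw [Finset.disjoint_union_left, Finset.disjoint_singleton_left]
      exact ⟨fun hh => hvUV (Finset.mem_union_right _ hh), h.disj⟩
    · rw [Finset.union_sdiff_right]
      exact (Finset.card_le_card Finset.sdiff_subset).trans (by simp)

/-- An edge inside one side would close two walks of equal parity from `a` into an odd closed walk.
-/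
theorem of_anchor (hF : CleanFamily W F) (hs : ∀ v ∈ W, ¬ F {v}) (hd : Disjoint U V)
    (hsub : U ∪ V ⊆ W) (a : α)
    (hU : ∀ u ∈ U, ∃ p : (pairGraph W F).Walk a u, Even p.length)
    (hV : ∀ v ∈ V, ∃ p : (pairGraph W F).Walk a v, Odd p.length)
    (hcl : ∀ u v, (pairGraph W F).Adj u v → u ∈ U ∪ V → v ∈ U ∪ V) : IsPart W F U V where
  disj := hd
  subset := hsub
  reachable := by
    have : ∀ u ∈ U ∪ V, (pairGraph W F).Reachable a u := by
      intro u hu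
      rcases Finset.mem_union.1 hu with hu | hu
      · obtain ⟨p, -⟩ := hU u hu; exact ⟨p⟩
      · obtain ⟨p, -⟩ := hV u hu; exact ⟨p⟩
    exact fun u hu v hv => (this u hu).symm.trans (this v hv)
  alt u v huv hu := by
    have key : ∀ (p : (pairGraph W F).Walk a u) (q : (pairGraph W F).Walk a v),
        ¬ Even (p.length + q.length) := by
      intro p q hev
      refine hF.walk_length_ne hs (p.length + q.length + 1) hev.add_one a
        (p.append (SimpleGraph.Walk.cons huv q.reverse)) ?_
      simp [add_assoc]
    have hv := hcl u v huv hu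
    rcases Finset.mem_union.1 hu with hu | hu <;> rcases Finset.mem_union.1 hv with hv | hv
    · obtain ⟨p, hp⟩ := hU u hu
      obtain ⟨q, hq⟩ := hU v hv
      exact absurd (hp.add hq) (key p q)
    · exact Or.inl ⟨hu, hv⟩
    · exact Or.inr ⟨hu, hv⟩
    · obtain ⟨p, hp⟩ := hV u hu
      obtain ⟨q, hq⟩ := hV v hv
      exact absurd (hp.add_odd hq) (key p q)

theorem exists_walk (h : IsPart W F U V) {W' : Finset α} {F' : Finset α → Prop}
    (hFF' : ∀ u v, F {u, v} → F' {u, v}) (hsub : U ∪ V ⊆ W') {a : α} (ha : a ∈ U) :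
    (∀ u ∈ U, ∃ p : (pairGraph W' F').Walk a u, Even p.length) ∧
    (∀ v ∈ V, ∃ p : (pairGraph W' F').Walk a v, Odd p.length) := by
  have ha' := Finset.mem_union_left V ha
  constructor
  · intro u hu
    obtain ⟨p⟩ := h.reachable a ha' u (Finset.mem_union_left _ hu)
    obtain ⟨q, hq⟩ := pairGraph_exists_walk hFF' p
      (fun x hx => hsub (h.walk_support_mem p ha' x hx))
    exact ⟨q, hq ▸ h.even_of_mem p ha hu⟩
  · intro v hv
    obtain ⟨p⟩ := h.reachable a ha' v (Finset.mem_union_right _ hv)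
    obtain ⟨q, hq⟩ := pairGraph_exists_walk hFF' p
      (fun x hx => hsub (h.walk_support_mem p ha' x hx))
    refine ⟨q, hq ▸ Nat.not_even_iff_odd.1 fun hev => ?_⟩
    exact Finset.disjoint_right.1 h.disj hv (((h.walk_parity p).1 ha).1 hev)

theorem transfer (h : IsPart W F U V) (hne : U.Nonempty) {W' : Finset α} {F' : Finset α → Prop}
    (hF' : CleanFamily W' F') (hs' : ∀ v ∈ W', ¬ F' {v})
    (hFF' : ∀ u v, F {u, v} → F' {u, v}) (hsub : U ∪ V ⊆ W')
    (hcl : ∀ u v, (pairGraph W' F').Adj u v → u ∈ U ∪ V → v ∈ U ∪ V) : IsPart W' F' U V := by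
  obtain ⟨a, ha⟩ := hne
  have := h.exists_walk hFF' hsub ha
  exact of_anchor hF' hs' h.disj hsub a this.1 this.2 hcl

/-- After contracting `U` and restricting to the second component, that component keeps its sides,
so `U'` is not a cover there. -/
theorem not_family_union_left (h₁ : IsPart W F U V) {U' V' : Finset α} (h₂ : IsPart W F U' V')
    (hne : U'.Nonempty) (hd : Disjoint (U' ∪ V') (U ∪ V)) (hF : CleanFamily W F) (h0 : ¬ F ∅)
    (hs : ∀ v ∈ W, ¬ F {v}) : ¬ F (U' ∪ U) := by
  obtain ⟨hF', h0', hs'⟩ := h₁.contract hF h0 hs h₂.subset hd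
  exact (h₂.transfer hne hF' hs' (fun u v => hF.mono _ _ Finset.subset_union_left)
    (Finset.Subset.refl _) (fun u v huv _ => huv.2.2.1)).not_family_left hF' h0' hs'

/-- The new edge merges the two components into one, whose sides are `U ∪ U'` and `V ∪ V'`. -/
theorem not_family_of_adj {U' V' : Finset α} (h₁ : IsPart W F U V)
    (h₂ : IsPart W F U' V') (hd : Disjoint (U ∪ V) (U' ∪ V')) {F' : Finset α → Prop}
    (hF' : CleanFamily (U ∪ V ∪ (U' ∪ V')) F') (h0' : ¬ F' ∅)
    (hs' : ∀ v ∈ U ∪ V ∪ (U' ∪ V'), ¬ F' {v})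
    (hFF' : ∀ u v, F {u, v} → F' {u, v}) {u v : α} (hu : u ∈ U) (hv : v ∈ V')
    (huv : (pairGraph (U ∪ V ∪ (U' ∪ V')) F').Adj u v) : ¬ F' (U ∪ U') ∧ ¬ F' (V ∪ V') := by
  have hw₁ := h₁.exists_walk hFF' (W' := U ∪ V ∪ (U' ∪ V')) Finset.subset_union_left hu
  have hw₂ := h₂.symm.exists_walk hFF' (W' := U ∪ V ∪ (U' ∪ V'))
    (by rw [Finset.union_comm V']; exact Finset.subset_union_right) hv
  have hpart : IsPart (U ∪ V ∪ (U' ∪ V')) F' (U ∪ U') (V ∪ V') := by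
    have heq : U ∪ U' ∪ (V ∪ V') = U ∪ V ∪ (U' ∪ V') := Finset.union_union_union_comm _ _ _ _
    refine of_anchor hF' hs' ?_ heq.subset u ?_ ?_
      (fun a b hab _ => by rw [heq]; exact hab.2.2.1)
    · have e1 := h₁.disj
      have e2 := h₂.disj
      simp only [Finset.disjoint_union_left, Finset.disjoint_union_right] at hd ⊢
      exact ⟨⟨e1, hd.1.2.symm⟩, ⟨hd.2.1, e2⟩⟩
    · intro w hw
      rcases Finset.mem_union.1 hw with hw | hw
      · exact hw₁.1 w hw
      · obtain ⟨p, hp⟩ := hw₂.2 w hw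
        exact ⟨SimpleGraph.Walk.cons huv p, by simpa using hp.add_one⟩
    · intro w hw
      rcases Finset.mem_union.1 hw with hw | hw
      · exact hw₁.2 w hw
      · obtain ⟨p, hp⟩ := hw₂.1 w hw
        exact ⟨SimpleGraph.Walk.cons huv p, by simpa using hp.add_one⟩
  exact ⟨hpart.not_family_left hF' h0' hs', hpart.symm.not_family_left hF' h0' hs'⟩

theorem not_family_diagonal {U' V' : Finset α} (h₁ : IsPart W F U V) (h₂ : IsPart W F U' V')
    (hne₁ : U.Nonempty) (hne₁' : V.Nonempty) (hne₂ : U'.Nonempty)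
    (hd : Disjoint (U ∪ V) (U' ∪ V')) {F' : Finset α → Prop}
    (hF' : CleanFamily (U ∪ V ∪ (U' ∪ V')) F') (h0' : ¬ F' ∅)
    (hs' : ∀ v ∈ U ∪ V ∪ (U' ∪ V'), ¬ F' {v}) (hFF' : ∀ u v, F {u, v} → F' {u, v}) :
    (¬ F' (U ∪ U') ∧ ¬ F' (V ∪ V')) ∨ (¬ F' (U ∪ V') ∧ ¬ F' (V ∪ U')) := by
  by_cases hcross : ∃ u ∈ U ∪ V, ∃ v ∈ U' ∪ V', (pairGraph (U ∪ V ∪ (U' ∪ V')) F').Adj u v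
  · obtain ⟨u, hu, v, hv, huv⟩ := hcross
    have e1 : V ∪ U = U ∪ V := Finset.union_comm _ _
    have e2 : V' ∪ U' = U' ∪ V' := Finset.union_comm _ _
    rcases Finset.mem_union.1 hu with hu | hu <;> rcases Finset.mem_union.1 hv with hv | hv
    · exact Or.inr (h₁.not_family_of_adj h₂.symm (by rwa [e2]) (by rwa [e2]) h0' (by rwa [e2])
        hFF' hu hv (by rwa [e2]))
    · exact Or.inl (h₁.not_family_of_adj h₂ hd hF' h0' hs' hFF' hu hv huv)
    · exact Or.inl (h₁.symm.not_family_of_adj h₂.symm (by rwa [e1, e2]) (by rwa [e1, e2]) h0'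
        (by rwa [e1, e2]) hFF' hu hv (by rwa [e1, e2])).symm
    · exact Or.inr (h₁.symm.not_family_of_adj h₂ (by rwa [e1]) (by rwa [e1]) h0'
        (by rwa [e1]) hFF' hu hv (by rwa [e1])).symm
  -- With no crossing edge both components persist under `F'`, and either alternative would do.
  · push Not at hcross
    have hp₁ := h₁.transfer hne₁ hF' hs' hFF' Finset.subset_union_left (by
      intro u v huv hu
      rcases Finset.mem_union.1 huv.2.2.1 with hv | hv
      · exact hv
      · exact absurd huv (hcross u hu v hv))
    have hp₂ := h₂.transfer hne₂ hF' hs' hFF' Finset.subset_union_right (by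
      intro u v huv hu
      rcases Finset.mem_union.1 huv.2.2.1 with hv | hv
      · exact absurd huv.symm (hcross v hv u hu)
      · exact hv)
    refine Or.inr ⟨?_, ?_⟩
    · rw [Finset.union_comm] at hd
      exact hp₂.symm.not_family_union_left hp₁ hne₁ (by
        rw [Finset.union_comm V', Finset.union_comm U]; exact hd) hF' h0' hs'
    · exact hp₂.not_family_union_left hp₁.symm hne₁' (by
        rw [Finset.union_comm V]; exact hd) hF' h0' hs'

/-- Contracting `U` may create edges between the other two components, which is why only one of the
diagonals is obtained. -/
theorem not_family_triple {U₂ V₂ U₃ V₃ : Finset α} (h₁ : IsPart W F U V)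
    (h₂ : IsPart W F U₂ V₂) (h₃ : IsPart W F U₃ V₃)
    (hne₂ : U₂.Nonempty) (hne₂' : V₂.Nonempty) (hne₃ : U₃.Nonempty)
    (hd₁₂ : Disjoint (U ∪ V) (U₂ ∪ V₂)) (hd₁₃ : Disjoint (U ∪ V) (U₃ ∪ V₃))
    (hd₂₃ : Disjoint (U₂ ∪ V₂) (U₃ ∪ V₃)) (hF : CleanFamily W F) (h0 : ¬ F ∅)
    (hs : ∀ v ∈ W, ¬ F {v}) :
    (¬ F (U₂ ∪ U₃ ∪ U) ∧ ¬ F (V₂ ∪ V₃ ∪ U)) ∨ (¬ F (U₂ ∪ V₃ ∪ U) ∧ ¬ F (V₂ ∪ U₃ ∪ U)) := by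
  obtain ⟨hF', h0', hs'⟩ := h₁.contract hF h0 hs
    (Finset.union_subset h₂.subset h₃.subset)
    (Finset.disjoint_union_left.2 ⟨hd₁₂.symm, hd₁₃.symm⟩)
  exact h₂.not_family_diagonal h₃ hne₂ hne₂' hne₃ hd₂₃ hF' h0' hs'
    (fun u v => hF.mono _ _ Finset.subset_union_left)

end IsPart

/-! ### Covers of minors, and clean clutters as clean families -/

namespace Clutter

/-- Two antichains that refine each other are equal. -/
theorem eq_of_refine {α : Type*} {F G : Finset (Finset α)}
    (hF : ∀ X ∈ F, ∀ Y ∈ F, X ⊆ Y → X = Y) (hG : ∀ X ∈ G, ∀ Y ∈ G, X ⊆ Y → X = Y)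
    (hFG : ∀ X ∈ F, ∃ Y ∈ G, Y ⊆ X) (hGF : ∀ X ∈ G, ∃ Y ∈ F, Y ⊆ X) : F = G := by
  ext X
  constructor
  · intro hX
    obtain ⟨Y, hY, hYX⟩ := hFG X hX
    obtain ⟨Z, hZ, hZY⟩ := hGF Y hY
    have := hF Z hZ X hX (hZY.trans hYX)
    rwa [← Finset.Subset.antisymm hYX (this ▸ hZY)]
  · intro hX
    obtain ⟨Y, hY, hYX⟩ := hGF X hX
    obtain ⟨Z, hZ, hZY⟩ := hFG Y hY
    have := hG Z hZ X hX (hZY.trans hYX)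
    rwa [← Finset.Subset.antisymm hYX (this ▸ hZY)]

variable {α : Type*} [DecidableEq α]

/-- `B` meets every member of `C`; unlike a cover, it need not lie in the ground set. -/
def Hits (C : Clutter α) (B : Finset α) : Prop := ∀ X ∈ C.members, (X ∩ B).Nonempty

theorem Hits.mono {C : Clutter α} {A B : Finset α} (hAB : A ⊆ B) (h : C.Hits A) : C.Hits B :=
  fun X hX => (h X hX).mono (Finset.inter_subset_inter_left hAB)

theorem exists_minimalSets_subset (F : Finset (Finset α)) {X : Finset α} (hX : X ∈ F) :
    ∃ Y ∈ minimalSets F, Y ⊆ X := by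
  obtain ⟨Y, hYX, hY⟩ := F.exists_le_minimal hX
  refine ⟨Y, Finset.mem_filter.2 ⟨hY.1, fun Z hZ hZY => ?_⟩, hYX⟩
  exact le_antisymm hZY (hY.2 hZ hZY)

theorem mem_minor_of_disjoint (C : Clutter α) {I J X : Finset α} (hX : X ∈ C.members)
    (hXI : Disjoint X I) : ∃ M ∈ (C.minor I J).members, M ⊆ X \ J :=
  exists_minimalSets_subset _
    (Finset.mem_image.2 ⟨X, Finset.mem_filter.2 ⟨hX, hXI⟩, rfl⟩)

theorem exists_of_mem_minor (C : Clutter α) {I J M : Finset α} (hM : M ∈ (C.minor I J).members) :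
    ∃ X ∈ C.members, Disjoint X I ∧ M = X \ J := by
  obtain ⟨X, hX, rfl⟩ := Finset.mem_image.1 (Finset.mem_filter.1 hM).1
  obtain ⟨hX1, hX2⟩ := Finset.mem_filter.1 hX
  exact ⟨X, hX1, hX2, rfl⟩

theorem hits_minor_iff (C : Clutter α) {I J Y : Finset α} (hYJ : Disjoint Y J) :
    (C.minor I J).Hits Y ↔ C.Hits (Y ∪ I) := by
  constructor
  · intro h X hX
    by_cases hXI : Disjoint X I
    · obtain ⟨M, hM, hMX⟩ := C.mem_minor_of_disjoint (J := J) hX hXI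
      exact (h M hM).mono (Finset.inter_subset_inter (hMX.trans Finset.sdiff_subset)
        Finset.subset_union_left)
    · rw [Finset.not_disjoint_iff] at hXI
      obtain ⟨a, ha, haI⟩ := hXI
      exact ⟨a, Finset.mem_inter.2 ⟨ha, Finset.mem_union_right _ haI⟩⟩
  · intro h M hM
    obtain ⟨X, hX, hXI, rfl⟩ := C.exists_of_mem_minor hM
    obtain ⟨a, ha⟩ := h X hX
    rw [Finset.mem_inter, Finset.mem_union] at ha
    have haY : a ∈ Y := ha.2.resolve_right (Finset.disjoint_left.1 hXI ha.1)
    exact ⟨a, Finset.mem_inter.2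
      ⟨Finset.mem_sdiff.2 ⟨ha.1, Finset.disjoint_left.1 hYJ haY⟩, haY⟩⟩

theorem exists_member_of_not_hits {C : Clutter α} {B : Finset α} (h : ¬ C.Hits B) :
    ∃ X ∈ C.members, X ⊆ C.ground \ B := by
  simp only [Hits, not_forall, Finset.not_nonempty_iff_eq_empty] at h
  obtain ⟨X, hX, hXB⟩ := h
  exact ⟨X, hX, fun a ha => Finset.mem_sdiff.2 ⟨C.subset_ground X hX ha,
    fun hB => Finset.notMem_empty a (hXB ▸ Finset.mem_inter.2 ⟨ha, hB⟩)⟩⟩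

theorem mem_blocker_iff (C : Clutter α) (B : Finset α) :
    B ∈ C.blocker.members ↔ C.IsCover B ∧ ∀ Y, C.IsCover Y → Y ⊆ B → Y = B := by
  simp only [blocker, minimalSets, Finset.mem_filter, Finset.mem_powerset]
  constructor
  · rintro ⟨⟨-, h1⟩, h2⟩
    exact ⟨h1, fun Y hY => h2 Y ⟨hY.1, hY⟩⟩
  · rintro ⟨h1, h2⟩
    exact ⟨⟨h1.1, h1⟩, fun Y hY => h2 Y hY.2⟩

theorem exists_blocker_subset (C : Clutter α) {B : Finset α} (hB : C.IsCover B) :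
    ∃ Y ∈ C.blocker.members, Y ⊆ B :=
  exists_minimalSets_subset _ (Finset.mem_filter.2 ⟨Finset.mem_powerset.2 hB.1, hB⟩)

theorem blocker_blocker (C : Clutter α) : C.blocker.blocker = C := by
  have hcov : ∀ X ∈ C.members, C.blocker.IsCover X := fun X hX =>
    ⟨C.subset_ground X hX, fun B hB => by
      rw [Finset.inter_comm]; exact ((C.mem_blocker_iff B).1 hB).1.2 X hX⟩
  have hmem : C.blocker.blocker.members = C.members := by
    refine eq_of_refine C.blocker.blocker.antichain C.antichain ?_ ?_
    · intro X hX
      have hX' := ((C.blocker.mem_blocker_iff X).1 hX).1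
      by_contra hcon
      push Not at hcon
      -- If `X` contains no member, its complement is a cover and contains a minimal cover that `X`
      -- misses.
      obtain ⟨B, hB, hBX⟩ := C.exists_blocker_subset (B := C.ground \ X)
        ⟨Finset.sdiff_subset, fun Y hY => by
          obtain ⟨a, ha, haX⟩ := Finset.not_subset.1 (hcon Y hY)
          exact ⟨a, Finset.mem_inter.2 ⟨ha, Finset.mem_sdiff.2 ⟨C.subset_ground Y hY ha, haX⟩⟩⟩⟩
      obtain ⟨a, ha⟩ := hX'.2 B hB
      rw [Finset.mem_inter] at ha
      exact (Finset.mem_sdiff.1 (hBX ha.1)).2 ha.2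
    · intro X hX
      exact C.blocker.exists_blocker_subset (hcov X hX)
  have hg : C.blocker.blocker.ground = C.ground := rfl
  cases hC : C.blocker.blocker
  cases C
  simp_all

/-- In both cases delete `I` and contract everything else outside the configuration. The covers of
the resulting minor then identify it as a delta, or its blocker as an extended odd hole. -/
theorem IsClean.cleanFamily {C : Clutter α} (hC : C.IsClean) :
    CleanFamily C.ground C.Hits where
  mono A B := Hits.mono
  delta I L a hI hL ha haL haI hLI hc h1 h2 h3 := by
    by_contra h4
    have hW : insert a L ∪ I ⊆ C.ground :=
      Finset.union_subset (Finset.insert_subset ha hL) hI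
    obtain ⟨J, hJ⟩ : ∃ J, J = C.ground \ (insert a L ∪ I) := ⟨_, rfl⟩
    have hdJ : ∀ Y, Y ⊆ insert a L → Disjoint Y J := by
      intro Y hY
      rw [hJ]
      exact Finset.disjoint_of_subset_left (hY.trans Finset.subset_union_left)
        Finset.disjoint_sdiff
    have hIJ : Disjoint I J := by
      rw [hJ]
      exact Finset.disjoint_of_subset_left Finset.subset_union_right Finset.disjoint_sdiff
    have hground : (C.minor I J).ground = insert a L := by
      ext x
      simp only [minor, hJ, Finset.mem_sdiff, Finset.mem_union, Finset.mem_insert]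
      constructor
      · tauto
      · intro hx
        have hxI : x ∉ I := by
          rcases hx with rfl | hx
          · exact haI
          · exact Finset.disjoint_left.1 hLI hx
        have : x ∈ C.ground := hW (by simp; tauto)
        tauto
    have hits : ∀ Y, Y ⊆ insert a L → ((C.minor I J).Hits Y ↔ C.Hits (Y ∪ I)) :=
      fun Y hY => C.hits_minor_iff (hdJ Y hY)
    obtain ⟨D, hD⟩ : ∃ D, D = C.minor I J := ⟨_, rfl⟩
    rw [← hD] at hground hits
    refine (hC D ⟨I, J, hI, hJ ▸ Finset.sdiff_subset, hIJ, hD⟩).1 ⟨?_, a, ?_, ?_⟩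
    · rw [hground, Finset.card_insert_of_notMem haL]; omega
    · rw [hground]; exact Finset.mem_insert_self _ _
    · rw [hground, Finset.erase_insert haL]
      have hL1 : D.Hits L := (hits L (Finset.subset_insert _ _)).2 h1
      have ha1 : ¬ D.Hits {a} := fun hh => h4 (by
        have := (hits {a} (by simp)).1 hh
        rwa [Finset.insert_eq])
      have hal : ∀ l ∈ L, D.Hits {a, l} := fun l hl =>
        (hits {a, l} (by
          intro x hx
          simp only [Finset.mem_insert, Finset.mem_singleton] at hx ⊢
          rcases hx with rfl | rfl <;> tauto)).2 (by
          simpa [Finset.insert_union] using h3 l hl)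
      have hLl : ∀ l ∈ L, ¬ D.Hits (L.erase l) := fun l hl hh =>
        h2 l hl ((hits _ ((Finset.erase_subset _ _).trans (Finset.subset_insert _ _))).1 hh)
      have hnot1 : ∀ l ∈ L, ¬ L ⊆ {a, l} := by
        intro l hl hs
        have : L ⊆ {l} := fun x hx => by
          have := hs hx
          simp only [Finset.mem_insert, Finset.mem_singleton] at this ⊢
          exact this.resolve_left (fun he => haL (he ▸ hx))
        have := Finset.card_le_card this
        simp at this; omega
      refine eq_of_refine D.antichain ?_ ?_ ?_
      · intro X hX Y hY hXY
        simp only [Finset.mem_insert, Finset.mem_image] at hX hY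
        rcases hX with rfl | ⟨l, hl, rfl⟩ <;> rcases hY with rfl | ⟨l', hl', rfl⟩
        · rfl
        · exact absurd hXY (hnot1 l' hl')
        · exact absurd (hXY (Finset.mem_insert_self _ _)) haL
        · have : l ∈ ({a, l'} : Finset α) := hXY (by simp)
          simp only [Finset.mem_insert, Finset.mem_singleton] at this
          rw [this.resolve_left (fun he => haL (he ▸ hl))]
      -- A member through `a` meets `L` and so contains a pair; a member avoiding `a` must contain
      -- every `l`, because `{a, l}` is a cover.
      · intro M hM
        by_cases haM : a ∈ M
        · obtain ⟨l, hl⟩ := hL1 M hM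
          rw [Finset.mem_inter] at hl
          refine ⟨{a, l}, Finset.mem_insert_of_mem (Finset.mem_image.2 ⟨l, hl.2, rfl⟩), ?_⟩
          intro x hx
          simp only [Finset.mem_insert, Finset.mem_singleton] at hx
          rcases hx with rfl | rfl
          · exact haM
          · exact hl.1
        · refine ⟨L, Finset.mem_insert_self _ _, fun l hl => ?_⟩
          obtain ⟨x, hx⟩ := hal l hl M hM
          simp only [Finset.mem_inter, Finset.mem_insert, Finset.mem_singleton] at hx
          rcases hx with ⟨hx, rfl | rfl⟩
          · exact absurd hx haM
          · exact hx
      -- Each set of the delta is the complement of a non-cover, hence contains a member.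
      · intro X hX
        simp only [Finset.mem_insert, Finset.mem_image] at hX
        rcases hX with rfl | ⟨l, hl, rfl⟩
        · obtain ⟨M, hM, hMs⟩ := exists_member_of_not_hits ha1
          refine ⟨M, hM, hMs.trans ?_⟩
          rw [hground]
          intro x; simp
          tauto
        · obtain ⟨M, hM, hMs⟩ := exists_member_of_not_hits (hLl l hl)
          refine ⟨M, hM, hMs.trans ?_⟩
          rw [hground]
          intro x; simp
          tauto
  hole I n a hI hn hodd hinj ha hs := by
    by_contra hcon
    push Not at hcon
    obtain ⟨W, hWdef⟩ : ∃ W, W = (Finset.range n).image a := ⟨_, rfl⟩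
    have hmemW : ∀ x, x ∈ W ↔ ∃ i < n, a i = x := by intro x; simp [hWdef]
    have haW : ∀ i < n, a i ∈ W := fun i hi => (hmemW _).2 ⟨i, hi, rfl⟩
    have hWI : Disjoint W I := by
      rw [Finset.disjoint_left]
      intro x hx
      obtain ⟨i, hi, rfl⟩ := (hmemW x).1 hx
      exact (Finset.mem_sdiff.1 (ha i hi)).2
    have hWg : W ⊆ C.ground := by
      intro x hx
      obtain ⟨i, hi, rfl⟩ := (hmemW x).1 hx
      exact (Finset.mem_sdiff.1 (ha i hi)).1
    obtain ⟨J, hJ⟩ : ∃ J, J = C.ground \ (W ∪ I) := ⟨_, rfl⟩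
    have hIJ : Disjoint I J := by
      rw [hJ]
      exact Finset.disjoint_of_subset_left Finset.subset_union_right Finset.disjoint_sdiff
    have hits : ∀ Y, Y ⊆ W → ((C.minor I J).Hits Y ↔ C.Hits (Y ∪ I)) := by
      intro Y hY
      refine C.hits_minor_iff ?_
      rw [hJ]
      exact Finset.disjoint_of_subset_left (hY.trans Finset.subset_union_left)
        Finset.disjoint_sdiff
    have hground : (C.minor I J).ground = W := by
      ext x
      simp only [minor, hJ, Finset.mem_sdiff, Finset.mem_union]
      constructor
      · tauto
      · intro hx
        have hxI : x ∉ I := Finset.disjoint_left.1 hWI hx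
        have := hWg hx
        tauto
    obtain ⟨D, hD⟩ : ∃ D, D = C.minor I J := ⟨_, rfl⟩
    rw [← hD] at hground hits
    refine (hC D ⟨I, J, hI, hJ ▸ Finset.sdiff_subset, hIJ, hD⟩).2
      ⟨D.blocker, ⟨n, a, hn, hodd, hinj, ?_, ?_⟩, D.blocker_blocker.symm⟩
    · exact hground.trans hWdef
    have hsing : ∀ x ∈ W, ¬ D.Hits {x} := by
      intro x hx hh
      obtain ⟨i, hi, rfl⟩ := (hmemW x).1 hx
      have := (hits {a i} (Finset.singleton_subset_iff.2 hx)).1 hh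
      rw [← Finset.insert_eq] at this
      exact hs i hi this
    have hcard : ∀ Y, D.IsCover Y → 2 ≤ Y.card := by
      intro Y hY
      have hYW : Y ⊆ W := hground ▸ hY.1
      by_contra hlt
      have h1 : Y.card ≤ 1 := by omega
      rcases Y.eq_empty_or_nonempty with rfl | ⟨y, hy⟩
      · exact hsing (a 0) (haW 0 (by omega)) (Hits.mono (Finset.empty_subset _) hY.2)
      · refine hsing y (hYW hy) (Hits.mono ?_ hY.2)
        intro x hx
        exact Finset.mem_singleton.2 (Finset.card_le_one.1 h1 x hx y hy)
    have hcyc : ∀ i < n, (i + 1) % n < n ∧ (i + 1) % n ≠ i := by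
      intro i hi
      refine ⟨Nat.mod_lt _ (by omega), ?_⟩
      rcases Nat.lt_or_ge (i + 1) n with h1 | h1
      · rw [Nat.mod_eq_of_lt h1]; omega
      · rw [show i + 1 = n by omega, Nat.mod_self]; omega
    have hedge : ∀ i j, i < n → j < n → i ≠ j →
        (D.IsCover {a i, a j} ↔ (j = (i + 1) % n ∨ i = (j + 1) % n)) := by
      intro i j hi hj hij
      have hsub : ({a i, a j} : Finset α) ⊆ W := by
        intro x hx
        simp only [Finset.mem_insert, Finset.mem_singleton] at hx
        rcases hx with rfl | rfl
        · exact haW i hi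
        · exact haW j hj
      rw [← hcon i j hi hj hij]
      have := hits _ hsub
      rw [Finset.insert_union, ← Finset.insert_eq] at this
      rw [← this]
      exact ⟨fun hh => hh.2, fun hh => ⟨hground ▸ hsub, hh⟩⟩
    have hpair : ∀ i < n, ({a i, a ((i + 1) % n)} : Finset α) ∈ D.blocker.members ∧
        ({a i, a ((i + 1) % n)} : Finset α).card = 2 := by
      intro i hi
      obtain ⟨h1, h2⟩ := hcyc i hi
      have hc : ({a i, a ((i + 1) % n)} : Finset α).card = 2 :=
        Finset.card_pair (fun he => h2 (hinj h1 hi he.symm))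
      refine ⟨(D.mem_blocker_iff _).2 ⟨(hedge i _ hi h1 h2.symm).2 (Or.inl rfl), ?_⟩, hc⟩
      intro Y hY hYs
      exact Finset.eq_of_subset_of_card_le hYs (by rw [hc]; exact hcard Y hY)
    ext X
    simp only [Finset.mem_filter, Finset.mem_image, Finset.mem_range]
    constructor
    · rintro ⟨hX, hXmin⟩
      have hXc := ((D.mem_blocker_iff X).1 hX).1
      have h2 : X.card = 2 := by
        have e1 := hcard X hXc
        have e2 := hXmin _ (hpair 0 (by omega)).1
        rw [(hpair 0 (by omega)).2] at e2
        omega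
      obtain ⟨x, y, hxy, rfl⟩ := Finset.card_eq_two.1 h2
      have hxW : x ∈ W := hground ▸ hXc.1 (by simp)
      have hyW : y ∈ W := hground ▸ hXc.1 (by simp)
      obtain ⟨i, hi, rfl⟩ := (hmemW x).1 hxW
      obtain ⟨j, hj, rfl⟩ := (hmemW y).1 hyW
      rcases (hedge i j hi hj (fun he => hxy (he ▸ rfl))).1 hXc with he | he
      · exact ⟨i, hi, by rw [he]⟩
      · exact ⟨j, hj, by rw [he, Finset.pair_comm]⟩
    · rintro ⟨i, hi, rfl⟩
      refine ⟨(hpair i hi).1, fun Y hY => ?_⟩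
      rw [(hpair i hi).2]
      exact hcard Y ((D.mem_blocker_iff Y).1 hY).1

end Clutter

/-! ### Tangled clutters: sides, transversals and the core -/

namespace Clutter

variable {α : Type*} [DecidableEq α] {C : Clutter α}

theorem IsTangled.two_le_card (h : C.IsTangled) {B : Finset α} (hB : C.IsCover B) :
    2 ≤ B.card := by
  have : C.coveringNumber ≤ (B.card : ℕ∞) := iInf₂_le B hB
  rw [h.1] at this
  exact_mod_cast this

theorem IsTangled.isMinimumCover_iff (h : C.IsTangled) {B : Finset α} :
    C.IsMinimumCover B ↔ C.IsCover B ∧ B.card = 2 := by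
  rw [IsMinimumCover, h.1]
  exact and_congr_right fun _ => by norm_cast

theorem IsTangled.not_hits_empty (h : C.IsTangled) : ¬ C.Hits ∅ := fun hh => by
  simpa using h.two_le_card (B := ∅) ⟨Finset.empty_subset _, hh⟩

theorem IsTangled.not_hits_singleton (h : C.IsTangled) : ∀ v ∈ C.ground, ¬ C.Hits {v} :=
  fun v hv hh => by
    simpa using h.two_le_card (B := {v}) ⟨Finset.singleton_subset_iff.2 hv, hh⟩

theorem IsTangled.graph_adj_iff (h : C.IsTangled) (u v : {v // v ∈ C.ground}) :
    C.graph.Adj u v ↔ (pairGraph C.ground C.Hits).Adj u.1 v.1 := by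
  constructor
  · intro huv
    exact ⟨fun he => huv.1 (Subtype.ext he), u.2, v.2, huv.2.1.2⟩
  · rintro ⟨hne, -, -, hF⟩
    refine ⟨fun he => hne (congrArg _ he), h.isMinimumCover_iff.2 ⟨⟨?_, hF⟩,
      Finset.card_pair hne⟩⟩
    exact Finset.insert_subset u.2 (Finset.singleton_subset_iff.2 v.2)

theorem IsTangled.exists_adj (h : C.IsTangled) {v : α} (hv : v ∈ C.ground) :
    ∃ u, (pairGraph C.ground C.Hits).Adj v u := by
  obtain ⟨B, hB, hvB⟩ := h.2 v hv
  obtain ⟨hc, h2⟩ := h.isMinimumCover_iff.1 hB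
  obtain ⟨u, hu, huv⟩ := Finset.exists_mem_ne (s := B) (by omega) v
  refine ⟨u, huv.symm, hv, hc.1 hu, ?_⟩
  have : ({v, u} : Finset α) = B := Finset.eq_of_subset_of_card_le
    (Finset.insert_subset hvB (Finset.singleton_subset_iff.2 hu))
    (by rw [Finset.card_pair huv.symm, h2])
  rw [this]; exact hc.2

/-- Having no odd closed walks, the pair graph is two-colourable; the colour classes cut each
component into its sides. -/
theorem IsTangled.exists_bipartitionList (h : C.IsTangled) (hC : C.IsClean) :
    ∃ U V : Fin C.rank → Finset α, C.IsBipartitionList U V := by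
  classical
  have hcol : (pairGraph C.ground C.Hits).Colorable 2 := by
    rw [SimpleGraph.two_colorable_iff_forall_loop_even]
    intro v p
    by_contra hodd
    exact hC.cleanFamily.walk_length_ne h.not_hits_singleton _ (Nat.not_even_iff_odd.1 hodd) v p rfl
  obtain ⟨κ⟩ := hcol
  let c : Fin C.rank ≃ C.graph.ConnectedComponent := (Finite.equivFin _).symm
  refine ⟨fun i => C.ground.filter (fun v => κ v = 0 ∧
      ∃ h : v ∈ C.ground, C.graph.connectedComponentMk ⟨v, h⟩ = c i),
    fun i => C.ground.filter (fun v => κ v = 1 ∧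
      ∃ h : v ∈ C.ground, C.graph.connectedComponentMk ⟨v, h⟩ = c i), c, fun i => ⟨?_, ?_, ?_⟩⟩
  · intro v
    simp only [Finset.mem_union, Finset.mem_filter]
    constructor
    · rintro (hh | hh) <;> exact hh.2.2
    · intro hh
      have : κ v = 0 ∨ κ v = 1 := by
        generalize κ v = t
        fin_cases t <;> simp
      rcases this with h1 | h1
      · exact Or.inl ⟨hh.1, h1, hh⟩
      · exact Or.inr ⟨hh.1, h1, hh⟩
  · rw [Finset.disjoint_left]
    intro v hv hv'
    have h1 := (Finset.mem_filter.1 hv).2.1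
    have h2 := (Finset.mem_filter.1 hv').2.1
    rw [h1] at h2
    exact absurd h2 (by decide)
  · intro u v huv hu
    have hv : C.graph.connectedComponentMk v = c i := by
      rw [← hu]; exact (SimpleGraph.ConnectedComponent.connectedComponentMk_eq_of_adj huv).symm
    have hne := κ.valid ((h.graph_adj_iff u v).1 huv)
    have : (κ u.1 = 0 ∧ κ v.1 = 1) ∨ (κ u.1 = 1 ∧ κ v.1 = 0) := by
      revert hne
      generalize κ u.1 = s
      generalize κ v.1 = t
      fin_cases s <;> fin_cases t <;> simp
    simp only [Finset.mem_filter]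
    exact this.imp (fun hh => ⟨⟨u.2, hh.1, u.2, hu⟩, ⟨v.2, hh.2, v.2, hv⟩⟩)
      (fun hh => ⟨⟨u.2, hh.1, u.2, hu⟩, ⟨v.2, hh.2, v.2, hv⟩⟩)

/-- The side `U i` or `V i`, according to the second component of `(i, b)`. -/
def side {r : ℕ} (U V : Fin r → Finset α) (e : Fin r × Fin 2) : Finset α :=
  if e.2 = 0 then U e.1 else V e.1

/-- The union of the sides chosen by a 0-1 point. -/
def sel {r : ℕ} (U V : Fin r → Finset α) (p : Fin r → Fin 2) : Finset α :=
  Finset.univ.biUnion (fun i => side U V (i, p i))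

section

variable {r : ℕ} {U V : Fin r → Finset α}

theorem IsBipartitionList.mem_ground (hL : C.IsBipartitionList U V) {i : Fin r} {v : α}
    (hv : v ∈ U i ∪ V i) : v ∈ C.ground := by
  obtain ⟨c, hc⟩ := hL
  exact (((hc i).1 v).1 hv).1

theorem IsBipartitionList.disjoint (hL : C.IsBipartitionList U V) {i j : Fin r} (hij : i ≠ j) :
    Disjoint (U i ∪ V i) (U j ∪ V j) := by
  obtain ⟨c, hc⟩ := hL
  rw [Finset.disjoint_left]
  intro v hv hv'
  obtain ⟨h1, h2⟩ := ((hc i).1 v).1 hv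
  obtain ⟨h3, h4⟩ := ((hc j).1 v).1 hv'
  exact hij (c.injective (h2.symm.trans h4))

theorem IsBipartitionList.isPart (hL : C.IsBipartitionList U V) (h : C.IsTangled) (i : Fin r) :
    IsPart C.ground C.Hits (U i) (V i) := by
  have hL' := hL
  obtain ⟨c, hc⟩ := hL
  obtain ⟨h1, h2, h3⟩ := hc i
  refine ⟨h2, fun v hv => hL'.mem_ground hv, ?_, ?_⟩
  · intro u hu v hv
    obtain ⟨hu1, hu2⟩ := (h1 u).1 hu
    obtain ⟨hv1, hv2⟩ := (h1 v).1 hv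
    let φ : C.graph →g pairGraph C.ground C.Hits :=
      ⟨Subtype.val, fun {a b} hab => (h.graph_adj_iff a b).1 hab⟩
    exact (SimpleGraph.ConnectedComponent.exact (hu2.trans hv2.symm)).map φ
  · intro u v huv hu
    obtain ⟨hu1, hu2⟩ := (h1 u).1 hu
    exact h3 ⟨u, hu1⟩ ⟨v, huv.2.2.1⟩ ((h.graph_adj_iff _ _).2 huv) hu2

theorem IsBipartitionList.exists_mem_side (hL : C.IsBipartitionList U V) {v : α}
    (hv : v ∈ C.ground) : ∃ e : Fin r × Fin 2, v ∈ side U V e := by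
  obtain ⟨c, hc⟩ := hL
  obtain ⟨i, hi⟩ := c.surjective (C.graph.connectedComponentMk ⟨v, hv⟩)
  rcases Finset.mem_union.1 (((hc i).1 v).2 ⟨hv, hi.symm⟩) with hh | hh
  · exact ⟨(i, 0), by simpa [side] using hh⟩
  · exact ⟨(i, 1), by simpa [side] using hh⟩

theorem side_subset (e : Fin r × Fin 2) : side U V e ⊆ U e.1 ∪ V e.1 := by
  unfold side
  split_ifs
  · exact Finset.subset_union_left
  · exact Finset.subset_union_right

theorem IsBipartitionList.eq_of_mem_side (hL : C.IsBipartitionList U V) {e e' : Fin r × Fin 2}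
    {v : α} (hv : v ∈ side U V e) (hv' : v ∈ side U V e') : e = e' := by
  have h1 : e.1 = e'.1 := by
    by_contra hne
    exact Finset.disjoint_left.1 (hL.disjoint hne) (side_subset _ hv) (side_subset _ hv')
  obtain ⟨i, b⟩ := e
  obtain ⟨j, b'⟩ := e'
  obtain rfl : i = j := h1
  obtain ⟨c, hc⟩ := hL
  have hd : v ∈ U i → v ∉ V i := fun hh => Finset.disjoint_left.1 (hc i).2.1 hh
  fin_cases b <;> fin_cases b' <;> simp_all [side]

theorem IsBipartitionList.mem_sel_iff (hL : C.IsBipartitionList U V) {e : Fin r × Fin 2} {v : α}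
    (hv : v ∈ side U V e) (p : Fin r → Fin 2) : v ∈ sel U V p ↔ p e.1 = e.2 := by
  simp only [sel, Finset.mem_biUnion, Finset.mem_univ, true_and]
  constructor
  · rintro ⟨i, hi⟩
    have := hL.eq_of_mem_side hv hi
    rw [this]
  · intro hp
    exact ⟨e.1, by rw [hp]; exact hv⟩

theorem IsBipartitionList.sel_subset_ground (hL : C.IsBipartitionList U V) (p : Fin r → Fin 2) :
    sel U V p ⊆ C.ground := by
  intro v hv
  obtain ⟨i, -, hi⟩ := Finset.mem_biUnion.1 hv
  exact hL.mem_ground (side_subset _ hi)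

/-- Adjacent elements lie in opposite sides. -/
theorem IsBipartitionList.side_adj (hL : C.IsBipartitionList U V) (h : C.IsTangled)
    {e : Fin r × Fin 2} {u v : α} (hu : u ∈ side U V e)
    (huv : (pairGraph C.ground C.Hits).Adj u v) : v ∈ side U V (e.1, 1 - e.2) := by
  obtain ⟨i, b⟩ := e
  have hP := hL.isPart h i
  have hd : u ∈ U i → u ∉ V i := fun hh => Finset.disjoint_left.1 hP.disj hh
  have := hP.alt u v huv (side_subset _ hu)
  fin_cases b <;> simp [side] at hu ⊢ <;> tauto

theorem IsBipartitionList.side_nonempty (hL : C.IsBipartitionList U V) (h : C.IsTangled)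
    (e : Fin r × Fin 2) : (side U V e).Nonempty := by
  have hL' := hL
  obtain ⟨c, hc⟩ := hL
  obtain ⟨w, hw⟩ := (c e.1).exists_rep
  have hw' : w.1 ∈ U e.1 ∪ V e.1 := ((hc e.1).1 w.1).2 ⟨w.2, hw⟩
  have hb : ∃ b, w.1 ∈ side U V (e.1, b) := by
    rcases Finset.mem_union.1 hw' with hh | hh
    · exact ⟨0, by simpa [side] using hh⟩
    · exact ⟨1, by simpa [side] using hh⟩
  obtain ⟨b, hb⟩ := hb
  obtain ⟨u, hu⟩ := h.exists_adj w.2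
  have hu' := hL'.side_adj h hb hu
  obtain ⟨i, b'⟩ := e
  by_cases he : b' = b
  · exact ⟨w.1, he ▸ hb⟩
  · have : b' = 1 - b := by
      revert he; fin_cases b <;> fin_cases b' <;> simp
    rw [this]
    exact ⟨u, hu'⟩

theorem IsBipartitionList.sel_injective (hL : C.IsBipartitionList U V) (h : C.IsTangled) :
    Function.Injective (sel U V) := by
  intro p q hpq
  funext i
  obtain ⟨v, hv⟩ := hL.side_nonempty h (i, q i)
  have := (hL.mem_sel_iff hv q).2 rfl
  rw [← hpq] at this
  exact (hL.mem_sel_iff hv p).1 this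

/-- A member avoiding `sel U V q` lies in the antipodal transversal `sel U V p`. It fills it: each
element of `sel U V p` has a neighbour on the opposite side, which the member avoids, and the member
must meet that edge. -/
theorem IsBipartitionList.sel_mem_members (hL : C.IsBipartitionList U V) (h : C.IsTangled)
    {p q : Fin r → Fin 2} (hpq : ∀ i, p i ≠ q i) (hq : ¬ C.Hits (sel U V q)) :
    sel U V p ∈ C.members := by
  obtain ⟨X, hX, hXs⟩ := exists_member_of_not_hits hq
  have hnot : ∀ v ∈ X, v ∈ sel U V p := by
    intro v hv
    have hv' := Finset.mem_sdiff.1 (hXs hv)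
    obtain ⟨e, he⟩ := hL.exists_mem_side hv'.1
    rw [hL.mem_sel_iff he] at hv' ⊢
    have h1 := hpq e.1
    generalize p e.1 = s at *
    generalize q e.1 = t at *
    generalize e.2 = b at *
    revert h1 hv'
    fin_cases s <;> fin_cases t <;> fin_cases b <;> simp
  have heq : sel U V p = X := by
    refine Finset.Subset.antisymm (fun v hv => ?_) hnot
    have hvg := hL.sel_subset_ground p hv
    obtain ⟨e, he⟩ := hL.exists_mem_side hvg
    obtain ⟨u, hu⟩ := h.exists_adj hvg
    have hu' := hL.side_adj h he hu
    rw [hL.mem_sel_iff he] at hv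
    obtain ⟨x, hx⟩ := hu.2.2.2 X hX
    simp only [Finset.mem_inter, Finset.mem_insert, Finset.mem_singleton] at hx
    rcases hx with ⟨hxX, rfl | rfl⟩
    · exact hxX
    · have := (hL.mem_sel_iff hu' p).1 (hnot _ hxX)
      simp only [hv] at this
      generalize e.2 = b at this
      revert this
      fin_cases b <;> simp
  rw [heq]; exact hX

theorem mem_core_iff {X : Finset α} : X ∈ C.core.members ↔ X ∈ C.members ∧
    ∃ y : Finset α → ℝ, C.IsFractionalPacking y ∧ ∑ Z ∈ C.members, y Z = 2 ∧ 0 < y X := by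
  classical
  simp [core]

/-- Complementary slackness: a member of the core meets each minimum cover exactly once. -/
theorem mem_core_adj {X : Finset α} (hX : X ∈ C.core.members) {u v : α}
    (huv : (pairGraph C.ground C.Hits).Adj u v) : u ∈ X ↔ v ∉ X := by
  classical
  obtain ⟨hXC, y, ⟨hy0, hy1⟩, hy2, hyX⟩ := mem_core_iff.1 hX
  have hor : ∀ Z ∈ C.members, u ∈ Z ∨ v ∈ Z := by
    intro Z hZ
    obtain ⟨x, hx⟩ := huv.2.2.2 Z hZ
    simp only [Finset.mem_inter, Finset.mem_insert, Finset.mem_singleton] at hx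
    rcases hx with ⟨hx, rfl | rfl⟩
    · exact Or.inl hx
    · exact Or.inr hx
  constructor
  · intro hu hv
    have h1 := hy1 u huv.2.1
    have h2 := hy1 v huv.2.2.1
    rw [Finset.sum_filter] at h1 h2
    -- Every member meets the edge, and `X` would be counted twice with positive weight; but the
    -- constraints at `u` and `v` sum to at most two, the value of `y`.
    have hlt : ∑ Z ∈ C.members, y Z <
        ∑ Z ∈ C.members, ((if u ∈ Z then y Z else 0) + (if v ∈ Z then y Z else 0)) := by
      refine Finset.sum_lt_sum (fun Z hZ => ?_) ⟨X, hXC, ?_⟩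
      · have := hy0 Z hZ
        rcases hor Z hZ with hh | hh <;> simp only [hh, if_true] <;> split_ifs <;> linarith
      · simp only [hu, hv, if_true]; linarith
    rw [Finset.sum_add_distrib] at hlt
    linarith
  · intro hv
    exact (hor X hXC).resolve_right hv

theorem IsBipartitionList.exists_sel_of_mem_core (hL : C.IsBipartitionList U V)
    (h : C.IsTangled) {X : Finset α} (hX : X ∈ C.core.members) : ∃ p, X = sel U V p := by
  classical
  -- Membership in `X` and in `U i` both flip along every edge, so whether they agree is constant on
  -- the component.
  have hwalk : ∀ (i : Fin r) {u v : α} (w : (pairGraph C.ground C.Hits).Walk u v),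
      u ∈ U i ∪ V i → ((u ∈ X ↔ u ∈ U i) ↔ (v ∈ X ↔ v ∈ U i)) := by
    intro i u v w
    induction w with
    | nil => simp
    | @cons a b c hab w ih =>
      intro ha
      have hP := hL.isPart h i
      have h1 := hP.alt a b hab ha
      have h2 := mem_core_adj hX hab
      have hda : a ∈ U i → a ∉ V i := fun hh => Finset.disjoint_left.1 hP.disj hh
      have hdb : b ∈ U i → b ∉ V i := fun hh => Finset.disjoint_left.1 hP.disj hh
      have hb : b ∈ U i ∪ V i := by rw [Finset.mem_union]; tauto
      rw [← ih hb]
      tauto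
  choose a ha using fun i => hL.side_nonempty h (i, 0)
  refine ⟨fun i => if a i ∈ X then 0 else 1, ?_⟩
  ext v
  constructor
  · intro hv
    obtain ⟨e, he⟩ := hL.exists_mem_side (C.core.subset_ground X hX hv)
    rw [hL.mem_sel_iff he]
    have haU : a e.1 ∈ U e.1 := by simpa [side] using ha e.1
    obtain ⟨w⟩ := (hL.isPart h e.1).reachable (a e.1) (Finset.mem_union_left _ haU) v
      (side_subset _ he)
    have := hwalk e.1 w (Finset.mem_union_left _ haU)
    have hd : v ∈ U e.1 → v ∉ V e.1 :=
      fun hh => Finset.disjoint_left.1 (hL.isPart h e.1).disj hh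
    obtain ⟨i, b⟩ := e
    fin_cases b <;> simp [side] at * <;> tauto
  · intro hv
    obtain ⟨e, he⟩ := hL.exists_mem_side (hL.sel_subset_ground _ hv)
    rw [hL.mem_sel_iff he] at hv
    have haU : a e.1 ∈ U e.1 := by simpa [side] using ha e.1
    obtain ⟨w⟩ := (hL.isPart h e.1).reachable (a e.1) (Finset.mem_union_left _ haU) v
      (side_subset _ he)
    have := hwalk e.1 w (Finset.mem_union_left _ haU)
    have hd : v ∈ U e.1 → v ∉ V e.1 :=
      fun hh => Finset.disjoint_left.1 (hL.isPart h e.1).disj hh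
    obtain ⟨i, b⟩ := e
    fin_cases b <;> simp [side] at * <;> tauto

/-- Core members are transversals, so their points lie in `T`. Conversely, weight `2 / T.card` on
each point of `T` has value two, and by balance it loads every element with exactly one. -/
theorem IsBipartitionList.core_members_eq (hL : C.IsBipartitionList U V) (h : C.IsTangled)
    {T : Finset (Fin r → Fin 2)} (hne : T.Nonempty) (hT : ∀ p, sel U V p ∈ C.members ↔ p ∈ T)
    (hbal : ∀ e : Fin r × Fin 2, 2 * (T.filter (fun p => p e.1 = e.2)).card = T.card) :
    C.core.members = T.image (sel U V) := by
  classical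
  ext X
  rw [Finset.mem_image]
  constructor
  · intro hX
    obtain ⟨p, rfl⟩ := hL.exists_sel_of_mem_core h hX
    exact ⟨p, (hT p).1 (mem_core_iff.1 hX).1, rfl⟩
  · rintro ⟨p, hp, rfl⟩
    have hinj := hL.sel_injective h
    have hc : (0 : ℝ) < T.card := by exact_mod_cast hne.card_pos
    have himg : C.members ∩ T.image (sel U V) = T.image (sel U V) := by
      refine Finset.inter_eq_right.2 fun X hX => ?_
      obtain ⟨q, hq, rfl⟩ := Finset.mem_image.1 hX
      exact (hT q).2 hq
    refine mem_core_iff.2 ⟨(hT p).2 hp,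
      fun Z => if Z ∈ T.image (sel U V) then 2 / (T.card : ℝ) else 0, ⟨?_, ?_⟩, ?_, ?_⟩
    · intro Z _
      dsimp only
      split_ifs <;> positivity
    · intro v hv
      obtain ⟨e, he⟩ := hL.exists_mem_side hv
      have hset : (C.members.filter (fun Z => v ∈ Z)) ∩ T.image (sel U V) =
          (T.filter (fun p => p e.1 = e.2)).image (sel U V) := by
        rw [Finset.filter_inter, himg, Finset.filter_image]
        congr 1
        exact Finset.filter_congr fun q _ => hL.mem_sel_iff he q
      rw [Finset.sum_ite_mem, hset, Finset.sum_const, Finset.card_image_of_injective _ hinj,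
        nsmul_eq_mul]
      have : (2 : ℝ) * ((T.filter (fun p => p e.1 = e.2)).card : ℝ) = T.card := by
        exact_mod_cast hbal e
      rw [mul_div_assoc', div_le_one hc]
      linarith
    · rw [Finset.sum_ite_mem, himg, Finset.sum_const, Finset.card_image_of_injective _ hinj,
        nsmul_eq_mul]
      field_simp
    · have : sel U V p ∈ T.image (sel U V) := Finset.mem_image_of_mem _ hp
      simp only [this, if_true]
      positivity

theorem IsBipartitionList.sel_inter_eq_iff (hL : C.IsBipartitionList U V) (h : C.IsTangled)
    (p : Fin r → Fin 2) (i : Fin r) : sel U V p ∩ (U i ∪ V i) = U i ↔ p i = 0 := by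
  have h0 : side U V (i, 0) = U i := by simp [side]
  constructor
  · intro he
    obtain ⟨v, hv⟩ := hL.side_nonempty h (i, 0)
    refine (hL.mem_sel_iff hv p).1 ?_
    rw [h0, ← he] at hv
    exact (Finset.mem_inter.1 hv).1
  · intro hp
    ext v
    rw [Finset.mem_inter]
    constructor
    · rintro ⟨hv, hv'⟩
      rcases Finset.mem_union.1 hv' with hv' | hv'
      · exact hv'
      · have := (hL.mem_sel_iff (e := (i, 1)) (by simpa [side] using hv') p).1 hv
        simp [hp] at this
    · intro hv
      exact ⟨(hL.mem_sel_iff (e := (i, 0)) (by rwa [h0]) p).2 hp, Finset.mem_union_left _ hv⟩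

theorem IsBipartitionList.setcoreWrt_eq (hL : C.IsBipartitionList U V) (h : C.IsTangled)
    {T : Finset (Fin r → Fin 2)} (hcore : C.core.members = T.image (sel U V)) :
    C.setcoreWrt U V = T := by
  rw [setcoreWrt, hcore, Finset.image_image]
  refine (Finset.image_congr fun p _ => ?_).trans Finset.image_id
  funext i
  simp only [Function.comp, hL.sel_inter_eq_iff h, id]
  generalize p i = t
  fin_cases t <;> simp

theorem IsBipartitionList.isDuplicationOf (hL : C.IsBipartitionList U V) (h : C.IsTangled)
    {T : Finset (Fin r → Fin 2)} (hcore : C.core.members = T.image (sel U V)) :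
    C.core.IsDuplicationOf (cuboid T) := by
  choose f hf using fun v : {v // v ∈ C.core.ground} => hL.exists_mem_side v.2
  refine ⟨fun v => ⟨f v, Finset.mem_univ _⟩, ?_, ?_⟩
  · rintro ⟨e, -⟩
    obtain ⟨v, hv⟩ := hL.side_nonempty h e
    refine ⟨⟨v, hL.mem_ground (side_subset _ hv)⟩, Subtype.ext ?_⟩
    exact hL.eq_of_mem_side (hf _) hv
  · intro X hX
    rw [hcore]
    simp only [cuboid, Finset.mem_image]
    constructor
    · rintro ⟨p, hp, rfl⟩
      exact ⟨_, ⟨p, hp, rfl⟩, fun v => by simp [hL.mem_sel_iff (hf v)]⟩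
    · rintro ⟨_, ⟨p, hp, rfl⟩, hv⟩
      refine ⟨p, hp, ?_⟩
      ext v
      constructor
      · intro hvs
        refine (hv ⟨v, hL.sel_subset_ground p hvs⟩).2 ?_
        simpa using (hL.mem_sel_iff (hf ⟨v, hL.sel_subset_ground p hvs⟩) p).1 hvs
      · intro hvX
        refine (hL.mem_sel_iff (hf ⟨v, hX hvX⟩) p).2 ?_
        simpa using (hv ⟨v, hX hvX⟩).1 hvX

end

/-! ### Duplications of cuboids -/

theorem IsDuplicationOf.translate {α : Type*} {r : ℕ} {D : Clutter α} {S : Finset (Fin r → Fin 2)}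
    (h : D.IsDuplicationOf (cuboid S)) (w : Fin r → Fin 2) :
    D.IsDuplicationOf (cuboid (S.image (· + w))) := by
  obtain ⟨f, hf, hmem⟩ := h
  refine ⟨fun v => ⟨((f v).1.1, (f v).1.2 + w (f v).1.1), Finset.mem_univ _⟩, ?_, ?_⟩
  · rintro ⟨⟨i, b⟩, -⟩
    obtain ⟨v, hv⟩ := hf ⟨(i, b - w i), Finset.mem_univ _⟩
    exact ⟨v, Subtype.ext (by simp [hv])⟩
  · intro X hX
    rw [hmem X hX]
    simp only [cuboid, Finset.exists_mem_image, Finset.mem_filter, Finset.mem_univ, true_and,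
      Pi.add_apply, add_left_inj]

/-- The set `g p` collects all copies of the cuboid elements selected by `p`. Surjectivity of the
copying map gives injectivity of `g` and a witness for each cuboid element. -/
theorem IsDuplicationOf.exists_injective {r : ℕ} {D : Clutter α} {S : Finset (Fin r → Fin 2)}
    (h : D.IsDuplicationOf (cuboid S)) : ∃ g : (Fin r → Fin 2) → Finset α,
      Function.Injective g ∧ D.members = S.image g ∧
      (∀ p q, (∀ i, p i ≠ q i) → Disjoint (g p) (g q)) ∧
      ∀ e : Fin r × Fin 2, ∃ v ∈ D.ground, ∀ p, v ∈ g p ↔ p e.1 = e.2 := by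
  classical
  obtain ⟨f, hf, hmem⟩ := h
  have hg : ∀ p : Fin r → Fin 2, ∃ X ⊆ D.ground,
      ∀ v : {v // v ∈ D.ground}, v.1 ∈ X ↔ p (f v).1.1 = (f v).1.2 := by
    intro p
    refine ⟨(D.ground.attach.filter (fun v => p (f v).1.1 = (f v).1.2)).image Subtype.val, ?_, ?_⟩
    · intro x hx
      obtain ⟨v, -, rfl⟩ := Finset.mem_image.1 hx
      exact v.2
    · intro v
      simp
  choose g hgs hg using hg
  have hpt : ∀ e : Fin r × Fin 2, ∃ v ∈ D.ground, ∀ p, v ∈ g p ↔ p e.1 = e.2 := by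
    intro e
    obtain ⟨v, hv⟩ := hf ⟨e, Finset.mem_univ _⟩
    exact ⟨v.1, v.2, fun p => by rw [hg, hv]⟩
  refine ⟨g, ?_, ?_, ?_, hpt⟩
  · intro p q hpq
    funext i
    obtain ⟨v, -, hv⟩ := hpt (i, q i)
    exact (hv p).1 (hpq ▸ (hv q).2 rfl)
  · ext X
    rw [Finset.mem_image]
    constructor
    · intro hX
      obtain ⟨Y, hY, hv⟩ := (hmem X (D.subset_ground X hX)).1 hX
      obtain ⟨p, hp, rfl⟩ := Finset.mem_image.1 hY
      refine ⟨p, hp, ?_⟩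
      ext v
      constructor
      · intro hvp
        exact (hv ⟨v, hgs p hvp⟩).2 (by simpa using (hg p ⟨v, hgs p hvp⟩).1 hvp)
      · intro hvX
        have hvg := D.subset_ground X hX hvX
        exact (hg p ⟨v, hvg⟩).2 (by simpa using (hv ⟨v, hvg⟩).1 hvX)
    · rintro ⟨p, hp, rfl⟩
      exact (hmem _ (hgs p)).2 ⟨_, Finset.mem_image_of_mem _ hp, fun v => by simp [hg]⟩
  · intro p q hpq
    rw [Finset.disjoint_left]
    intro v hv hv'
    exact hpq _ (((hg p ⟨v, hgs p hv⟩).1 hv).trans ((hg q ⟨v, hgs p hv⟩).1 hv').symm)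

end Clutter

/-! ### The core and the setcores in ranks one, two and three -/

namespace Clutter

section

variable {α : Type*} [DecidableEq α] {C : Clutter α} {r : ℕ} {U V : Fin r → Finset α}

theorem IsBipartitionList.isPart_side (hL : C.IsBipartitionList U V) (h : C.IsTangled)
    (i : Fin r) (b : Fin 2) :
    IsPart C.ground C.Hits (side U V (i, b)) (side U V (i, 1 - b)) := by
  have hP := hL.isPart h i
  fin_cases b
  · simpa [side] using hP
  · simpa [side] using hP.symm

theorem IsBipartitionList.disjoint_side (hL : C.IsBipartitionList U V) {i j : Fin r}
    (hij : i ≠ j) (b c b' c' : Fin 2) :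
    Disjoint (side U V (i, b) ∪ side U V (i, c)) (side U V (j, b') ∪ side U V (j, c')) :=
  Finset.disjoint_of_subset_left (Finset.union_subset (side_subset _) (side_subset _))
    (Finset.disjoint_of_subset_right (Finset.union_subset (side_subset _) (side_subset _))
      (hL.disjoint hij))

/-- The degrees of the elements of the core determine those of the points of a setcore. -/
theorem IsBipartitionList.card_of_isDuplicationOf (hL : C.IsBipartitionList U V)
    (h : C.IsTangled) {T S : Finset (Fin r → Fin 2)} (hcore : C.core.members = T.image (sel U V))
    (hbal : ∀ e : Fin r × Fin 2, 2 * (T.filter (fun p => p e.1 = e.2)).card = T.card)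
    (hS : C.core.IsDuplicationOf (cuboid S)) : S.card = T.card ∧
      ∀ e : Fin r × Fin 2, 2 * (S.filter (fun p => p e.1 = e.2)).card = T.card := by
  obtain ⟨g, hginj, hg, -, hpt⟩ := hS.exists_injective
  have hinj := hL.sel_injective h
  constructor
  · rw [← Finset.card_image_of_injective S hginj, ← hg, hcore,
      Finset.card_image_of_injective _ hinj]
  · intro e
    obtain ⟨v, hv, hve⟩ := hpt e
    obtain ⟨e', he'⟩ := hL.exists_mem_side hv
    rw [← hbal e']
    have h1 : (C.core.members.filter (fun X => v ∈ X)).card =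
        (S.filter (fun p => p e.1 = e.2)).card := by
      rw [hg, Finset.filter_image, Finset.card_image_of_injective _ hginj]
      simp only [hve]
    have h2 : (C.core.members.filter (fun X => v ∈ X)).card =
        (T.filter (fun p => p e'.1 = e'.2)).card := by
      rw [hcore, Finset.filter_image, Finset.card_image_of_injective _ hinj]
      simp only [hL.mem_sel_iff he']
    rw [← h1, h2]

theorem exists_bipartitionList_of_rank (h : C.IsTangled) (hC : C.IsClean) (hr : C.rank = r) :
    ∃ U V : Fin r → Finset α, C.IsBipartitionList U V := by
  subst hr
  exact h.exists_bipartitionList hC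

end

section

variable {α : Type*} [DecidableEq α] {C : Clutter α}

theorem sel_fin_one (U V : Fin 1 → Finset α) (p : Fin 1 → Fin 2) :
    sel U V p = side U V (0, p 0) := by
  ext v; simp [sel]

theorem sel_fin_two (U V : Fin 2 → Finset α) (p : Fin 2 → Fin 2) :
    sel U V p = side U V (0, p 0) ∪ side U V (1, p 1) := by
  ext v; simp [sel, Fin.exists_fin_two]

theorem sel_fin_three (U V : Fin 3 → Finset α) (p : Fin 3 → Fin 2) :
    sel U V p = side U V (0, p 0) ∪ side U V (1, p 1) ∪ side U V (2, p 2) := by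
  ext v; simp [sel, Fin.exists_fin_succ]

theorem IsBipartitionList.core_rank_one {U V : Fin 1 → Finset α}
    (hL : C.IsBipartitionList U V) (h : C.IsTangled) (hC : C.IsClean) :
    C.core.members = ({![0], ![1]} : Finset (Fin 1 → Fin 2)).image (sel U V) := by
  refine hL.core_members_eq h (by simp) (fun p => ⟨fun _ => by clear * -; revert p; decide, fun _ => ?_⟩)
    (by decide)
  refine hL.sel_mem_members h (q := fun i => 1 - p i)
    (fun i => (by decide : ∀ t : Fin 2, t ≠ 1 - t) (p i)) ?_
  rw [sel_fin_one]
  exact (hL.isPart_side h 0 _).not_family_left hC.cleanFamily h.not_hits_empty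
    h.not_hits_singleton

theorem IsBipartitionList.core_rank_two {U V : Fin 2 → Finset α}
    (hL : C.IsBipartitionList U V) (h : C.IsTangled) (hC : C.IsClean) :
    C.core.members =
      ({![0, 0], ![1, 0], ![0, 1], ![1, 1]} : Finset (Fin 2 → Fin 2)).image (sel U V) := by
  refine hL.core_members_eq h (by simp) (fun p => ⟨fun _ => by clear * -; revert p; decide, fun _ => ?_⟩)
    (by decide)
  refine hL.sel_mem_members h (q := fun i => 1 - p i)
    (fun i => (by decide : ∀ t : Fin 2, t ≠ 1 - t) (p i)) ?_
  rw [sel_fin_two]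
  exact (hL.isPart_side h 1 _).not_family_union_left (hL.isPart_side h 0 _)
    (hL.side_nonempty h _) (hL.disjoint_side (by decide) _ _ _ _) hC.cleanFamily
    h.not_hits_empty h.not_hits_singleton

/-- Members are antipodes of non-covers, so members with first coordinate `b` come from contracting
the side `1 - b` of the first component. -/
theorem IsBipartitionList.members_rank_three {U V : Fin 3 → Finset α}
    (hL : C.IsBipartitionList U V) (h : C.IsTangled) (hC : C.IsClean) (b : Fin 2) :
    (sel U V ![b, 0, 0] ∈ C.members ∧ sel U V ![b, 1, 1] ∈ C.members) ∨
    (sel U V ![b, 0, 1] ∈ C.members ∧ sel U V ![b, 1, 0] ∈ C.members) := by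
  have key := (hL.isPart_side h 0 (1 - b)).not_family_triple (hL.isPart_side h 1 0)
    (hL.isPart_side h 2 0) (hL.side_nonempty h _) (hL.side_nonempty h _) (hL.side_nonempty h _)
    (hL.disjoint_side (by decide) _ _ _ _) (hL.disjoint_side (by decide) _ _ _ _)
    (hL.disjoint_side (by decide) _ _ _ _) hC.cleanFamily h.not_hits_empty h.not_hits_singleton
  have hmem : ∀ c d : Fin 2,
      ¬ C.Hits (side U V (1, 1 - c) ∪ side U V (2, 1 - d) ∪ side U V (0, 1 - b)) →
      sel U V ![b, c, d] ∈ C.members := by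
    intro c d hn
    refine hL.sel_mem_members h (q := ![1 - b, 1 - c, 1 - d]) ?_ ?_
    · clear * -; revert b c d; decide
    · rw [sel_fin_three]
      simp only [Matrix.cons_val]
      rwa [Finset.union_assoc, Finset.union_comm]
  rcases key with hk | hk
  · exact Or.inl ⟨hmem 0 0 hk.2, hmem 1 1 hk.1⟩
  · exact Or.inr ⟨hmem 0 1 hk.2, hmem 1 0 hk.1⟩

theorem IsBipartitionList.core_rank_three {U V : Fin 3 → Finset α}
    (hL : C.IsBipartitionList U V) (h : C.IsTangled) (hC : C.IsClean)
    (hdisj : ∀ X ∈ C.members, ∀ Y ∈ C.members, X ≠ Y → ¬ Disjoint X Y) :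
    C.core.members = ({![0, 0, 0], ![1, 1, 0], ![1, 0, 1], ![0, 1, 1]} :
      Finset (Fin 3 → Fin 2)).image (sel U V) ∨
    C.core.members = ({![1, 0, 0], ![0, 1, 0], ![0, 0, 1], ![1, 1, 1]} :
      Finset (Fin 3 → Fin 2)).image (sel U V) := by
  have hanti : ∀ p q : Fin 3 → Fin 2, (∀ i, p i ≠ q i) → sel U V p ∈ C.members →
      sel U V q ∈ C.members → False := by
    intro p q hpq hp hq
    refine hdisj _ hp _ hq (fun he => hpq 0 (congrFun (hL.sel_injective h he) 0)) ?_
    rw [Finset.disjoint_left]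
    intro v hv hv'
    obtain ⟨e, he⟩ := hL.exists_mem_side (hL.sel_subset_ground _ hv)
    exact hpq e.1 (((hL.mem_sel_iff he p).1 hv).trans ((hL.mem_sel_iff he q).1 hv').symm)
  have hfin : ∀ T : Finset (Fin 3 → Fin 2), T.Nonempty → (∀ p ∈ T, sel U V p ∈ C.members) →
      (∀ p, p ∈ T ∨ ∃ q ∈ T, ∀ i, p i ≠ q i) →
      (∀ e : Fin 3 × Fin 2, 2 * (T.filter (fun p => p e.1 = e.2)).card = T.card) →
      C.core.members = T.image (sel U V) := by
    intro T hne hT hcov hbal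
    refine hL.core_members_eq h hne (fun p => ⟨fun hp => ?_, hT p⟩) hbal
    rcases hcov p with hpT | ⟨q, hq, hpq⟩
    · exact hpT
    · exact (hanti p q hpq hp (hT q hq)).elim
  -- Choosing the same diagonal for both values of the first coordinate would give two antipodal
  -- members. The mixed choices give the even and the odd parity class.
  rcases hL.members_rank_three h hC 0 with h0 | h0 <;>
    rcases hL.members_rank_three h hC 1 with h1 | h1
  · exact (hanti _ _ (by decide) h0.1 h1.2).elim
  · refine Or.inl (hfin _ (by simp) ?_ (by decide) (by decide))
    simp only [Finset.forall_mem_insert, Finset.mem_singleton, forall_eq]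
    exact ⟨h0.1, h1.2, h1.1, h0.2⟩
  · refine Or.inr (hfin _ (by simp) ?_ (by decide) (by decide))
    simp only [Finset.forall_mem_insert, Finset.mem_singleton, forall_eq]
    exact ⟨h1.1, h0.2, h0.1, h1.2⟩
  · exact (hanti _ _ (by decide) h0.1 h1.2).elim

/-- Balance forces four points, so one is chosen from each antipodal pair; among such choices only
the two parity classes are balanced. The check runs over all subsets of the cube. -/
theorem eq_of_balanced_fin_three : ∀ S : Finset (Fin 3 → Fin 2),
    (∀ e : Fin 3 × Fin 2, 2 * (S.filter (fun p => p e.1 = e.2)).card = 4) →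
    (∀ p ∈ S, ∀ q ∈ S, ¬ ∀ i, p i ≠ q i) →
    S = {![0, 0, 0], ![1, 1, 0], ![1, 0, 1], ![0, 1, 1]} ∨
      S = {![1, 0, 0], ![0, 1, 0], ![0, 0, 1], ![1, 1, 1]} := by
  decide +kernel

end

end Clutter

/-! ### Assembling the theorem -/

theorem mainTheorem10 {α : Type*} [DecidableEq α] (C : Clutter α)
    (hclean : C.IsClean) (htangled : C.IsTangled) :
    (∃ U V : Fin C.rank → Finset α, C.IsBipartitionList U V) ∧
    (C.rank = 1 →
      (∀ S : Finset (Fin 1 → Fin 2), C.IsSetcore S ↔ S = {![0], ![1]}) ∧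
      ∀ U V : Fin 1 → Finset α, C.IsBipartitionList U V →
        C.setcoreWrt U V = {![0], ![1]} ∧ C.core.members = {U 0, V 0}) ∧
    (C.rank = 2 →
      (∀ S : Finset (Fin 2 → Fin 2), C.IsSetcore S ↔
        S = {![0, 0], ![1, 0], ![0, 1], ![1, 1]}) ∧
      ∀ U V : Fin 2 → Finset α, C.IsBipartitionList U V →
        C.setcoreWrt U V = {![0, 0], ![1, 0], ![0, 1], ![1, 1]} ∧
        C.core.members = {U 0 ∪ U 1, U 0 ∪ V 1, V 0 ∪ U 1, V 0 ∪ V 1}) ∧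
    (C.rank = 3 → (∀ X ∈ C.members, ∀ Y ∈ C.members, X ≠ Y → ¬ Disjoint X Y) →
      (∀ S : Finset (Fin 3 → Fin 2), C.IsSetcore S ↔
        S = {![0, 0, 0], ![1, 1, 0], ![1, 0, 1], ![0, 1, 1]} ∨
        S = {![1, 0, 0], ![0, 1, 0], ![0, 0, 1], ![1, 1, 1]}) ∧
      ∀ U V : Fin 3 → Finset α, C.IsBipartitionList U V →
        (C.setcoreWrt U V = {![0, 0, 0], ![1, 1, 0], ![1, 0, 1], ![0, 1, 1]} ∧
          C.core.members = {U 0 ∪ U 1 ∪ U 2, U 0 ∪ V 1 ∪ V 2,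
            V 0 ∪ U 1 ∪ V 2, V 0 ∪ V 1 ∪ U 2}) ∨
        (C.setcoreWrt U V = {![1, 0, 0], ![0, 1, 0], ![0, 0, 1], ![1, 1, 1]} ∧
          C.core.members = {U 0 ∪ U 1 ∪ V 2, U 0 ∪ V 1 ∪ U 2,
            V 0 ∪ U 1 ∪ U 2, V 0 ∪ V 1 ∪ V 2})) := by
  refine ⟨htangled.exists_bipartitionList hclean, fun hr => ?_, fun hr => ?_, fun hr hdisj => ?_⟩
  · refine ⟨fun S => ⟨fun hS => ?_, ?_⟩, fun U V hL => ?_⟩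
    · obtain ⟨U, V, hL⟩ := Clutter.exists_bipartitionList_of_rank htangled hclean hr
      have hcard := (hL.card_of_isDuplicationOf htangled (hL.core_rank_one htangled hclean)
        (by decide) hS.2).1
      -- The core has as many members as the cube has points, so a setcore must be the whole cube.
      rw [Finset.eq_univ_of_card S (hcard.trans (by decide))]
      decide
    · rintro rfl
      obtain ⟨U, V, hL⟩ := Clutter.exists_bipartitionList_of_rank htangled hclean hr
      exact ⟨hr, hL.isDuplicationOf htangled (hL.core_rank_one htangled hclean)⟩
    · have hcore := hL.core_rank_one htangled hclean
      refine ⟨hL.setcoreWrt_eq htangled hcore, hcore.trans ?_⟩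
      simp [Clutter.sel_fin_one, Clutter.side]
  · refine ⟨fun S => ⟨fun hS => ?_, ?_⟩, fun U V hL => ?_⟩
    · obtain ⟨U, V, hL⟩ := Clutter.exists_bipartitionList_of_rank htangled hclean hr
      have hcard := (hL.card_of_isDuplicationOf htangled (hL.core_rank_two htangled hclean)
        (by decide) hS.2).1
      rw [Finset.eq_univ_of_card S (hcard.trans (by decide))]
      decide
    · rintro rfl
      obtain ⟨U, V, hL⟩ := Clutter.exists_bipartitionList_of_rank htangled hclean hr
      exact ⟨hr, hL.isDuplicationOf htangled (hL.core_rank_two htangled hclean)⟩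
    · have hcore := hL.core_rank_two htangled hclean
      refine ⟨hL.setcoreWrt_eq htangled hcore, hcore.trans ?_⟩
      ext X
      simp only [Finset.mem_image, Finset.mem_insert, Finset.mem_singleton,
        Clutter.sel_fin_two, Clutter.side]
      simp [eq_comm]
      tauto
  · refine ⟨fun S => ⟨fun hS => ?_, fun hS => ?_⟩, fun U V hL => ?_⟩
    · obtain ⟨U, V, hL⟩ := Clutter.exists_bipartitionList_of_rank htangled hclean hr
      refine Clutter.eq_of_balanced_fin_three S ?_ ?_
      · rcases hL.core_rank_three htangled hclean hdisj with hcore | hcore <;>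
          exact (hL.card_of_isDuplicationOf htangled hcore (by decide) hS.2).2
      · intro p hp q hq hpq
        obtain ⟨g, hginj, hg, hgd, -⟩ := hS.2.exists_injective
        have hmem : ∀ p ∈ S, g p ∈ C.members := fun p hp =>
          (Clutter.mem_core_iff.1 (hg ▸ Finset.mem_image_of_mem g hp)).1
        exact hdisj _ (hmem p hp) _ (hmem q hq)
          (fun he => hpq 0 (congrFun (hginj he) 0)) (hgd p q hpq)
    · obtain ⟨U, V, hL⟩ := Clutter.exists_bipartitionList_of_rank htangled hclean hr
      refine ⟨hr, ?_⟩
      rcases hL.core_rank_three htangled hclean hdisj with hcore | hcore <;>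
        have hdup := hL.isDuplicationOf htangled hcore <;>
        -- Flipping the first coordinate exchanges the two parity classes, so both are setcores
        -- whichever one comes from the given naming of the sides.
        have hdup' := hdup.translate ![1, 0, 0] <;>
        rcases hS with rfl | rfl
      · exact hdup
      · convert hdup' using 2; decide
      · convert hdup' using 2; decide
      · exact hdup
    · rcases hL.core_rank_three htangled hclean hdisj with hcore | hcore
      · refine Or.inl ⟨hL.setcoreWrt_eq htangled hcore, hcore.trans ?_⟩
        ext X
        simp only [Finset.mem_image, Finset.mem_insert, Finset.mem_singleton,
          Clutter.sel_fin_three, Clutter.side]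
        simp [eq_comm]
        tauto
      · refine Or.inr ⟨hL.setcoreWrt_eq htangled hcore, hcore.trans ?_⟩
        ext X
        simp only [Finset.mem_image, Finset.mem_insert, Finset.mem_singleton,
          Clutter.sel_fin_three, Clutter.side]
        simp [eq_comm]
        tauto
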